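/- Let $G$ be a connected real Lie group (finite-dimensional) with semisimple Lie algebra $\mathfrak g$, let $\sigma\neq\mathrm{id}$ be a smooth involutive automorphism of $G$ whose fixed-point group $K=\{g:\sigma(g)=g\}$ is compact, and let $\mathfrak p=\{X\in\mathfrak g:\sigma_*X=-X\}$, $\mathfrak k=\{X\in\mathfrak g:\sigma_*X=X\}$. Let $\langle\cdot,\cdot\rangle$ be a scalar multiple of the Killing form of $\mathfrak g$ that is positive definite on $\mathfrak k$. An element $X\in\mathfrak p$ is *regular* if $\{B\in\mathfrak p:[X,B]=0\}$ is abelian. Fix a regular $A\in\mathfrak p$ and $T>0$. *The affine problem.* A *control* is a bounded measurable $U:[0,T]\to\mathfrak k$; a *trajectory* with control $U$ is an absolutely continuous curve $g:[0,T]\to G$ with $\frac{dg}{dt}=g(t)(A+U(t))$ for almost every $t$. It is *optimal* if $\frac12\int_0^T\langle U,U\rangle\,dt$ is minimal among all controls having a trajectory on $[0,T]$ with the same end points. For $\lambda\le 0$ and $l\in\mathfrak g^*$ put $H_U(\lambda,l)=\frac{\lambda}{2}\langle U,U\rangle+l(A+U)$. Fix $\varepsilon\in\{1,-1\}$ (the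 choice of sign convention for the bracket: $\varepsilon=1$ gives the Hamiltonian flow when $[\cdot,\cdot]$ is the bracket of left-invariant vector fields, $\varepsilon=-1$ when it is its negative). An *extremal curve* with control $U$ is a pair $(g,l)$ of a trajectory $g$ with control $U$ and an absolutely continuous curve $l:[0,T]\to\mathfrak g^*$ such that $\frac{dl}{dt}=\varepsilon\, l\circ\mathrm{ad}(A+U(t))$ almost everywhere, $H_{U(t)}(\lambda,l(t))\ge H_V(\lambda,l(t))$ for almost every $t$ and all $V\in\mathfrak k$, and, if $\lambda=0$, $l(t)\neq0$ for all $t\in[0,T]$. It is *abnormal* if $\lambda=0$, and *normal* if $\lambda<0$, normalized to $\lambda=-1$. Then: 1. Let $g,l$ be curves and $U$ a function on $[0,T]$ with values in $G$, $\mathfrak g^*$ and $\mathfrak g$. Then $(g,l)$ is an abnormal extremal curve with control $U$ if and only if $g$ is a trajectory with control $U$ and there is a constant $L_{\mathfrak p}\in\mathfrak p$, $L_{\mathfrak p}\ne0$, such that $l(t)=\langle L_{\mathfrak p},\cdot\rangle$ for all $t\in[0,T]$, $[A,L_{\mathfrak p}]=0$, and $[L_{\mathfrak p},U(t)]=0$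 for almost every $t\in[0,T]$. 2. If $(g,l)$ is an abnormal extremal curve with control $U$ for which the element $L_{\mathfrak p}$ in (1) is regular, and if $g$ is optimal, then $g$ is also the projection of a normal extremal curve $(g,l')$ with control $U$, and $U$ is almost everywhere equal to a constant element of $\mathfrak k$ that commutes with $A$. 3. (The shadow problem.) The same two statements hold for the affine problem on the semidirect product $G_s=\mathfrak p\rtimes K$, with group law $(x_1,h_1)(x_2,h_2)=(x_1+\mathrm{Ad}_{h_1}x_2,\,h_1h_2)$. There a trajectory is an absolutely continuous curve $(x,h)$ in $\mathfrak p\times K$ with $\frac{dx}{dt}=\mathrm{Ad}_{h(t)}A$, $\frac{dh}{dt}=h(t)U(t)$ almost everywhere, and in the equation for $l$ the bracket of $\mathfrak g$ is replaced by the semidirect bracket $[A_1+B_1,A_2+B_2]_0=[B_1,A_2]-[B_2,A_1]+[B_1,B_2]$ ($A_i\in\mathfrak p$, $B_i\in\mathfrak k$); the form $\langle\cdot,\cdot\rangle$, regularity, and the brackets in $[A,L_{\mathfrak p}]$, $[L_{\mathfrak p},U(t)]$ and "commutes" are those of $\mathfrak g$. -/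

import Mathlib

open MeasureTheory Set
open scoped Manifold ContDiff

/-- A smooth real Lie group is of the smoothness class which Mathlib requires for the Lie bracket on
the tangent space at the identity. -/
instance instLieGroupMinSmoothnessThree {E : Type*} [NormedAddCommGroup E] [NormedSpace ℝ E]
    {G : Type*} [TopologicalSpace G] [ChartedSpace E G] [Group G] [LieGroup 𝓘(ℝ, E) ∞ G] :
    LieGroup 𝓘(ℝ, E) (minSmoothness ℝ 3) G :=
  LieGroup.of_le (n := ∞) (by
    rw [minSmoothness_of_isRCLikeNormedField]
    exact ENat.LEInfty.out)

namespace AffineKilling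

section

variable {E : Type*} [NormedAddCommGroup E] [NormedSpace ℝ E]
  {G : Type*} [TopologicalSpace G] [ChartedSpace E G] [Group G]

variable (E G) in
/-- The Lie algebra `𝔤` of `G`: the tangent space at the identity. -/
abbrev LieAlg : Type _ := GroupLieAlgebra 𝓘(ℝ, E) G

/-- The tangent map `σ_* : 𝔤 → 𝔤` of `σ` at the identity. -/
noncomputable def tangentMap (σ : G →* G) : LieAlg E G →ₗ[ℝ] LieAlg E G :=
  (mfderiv 𝓘(ℝ, E) 𝓘(ℝ, E) σ 1).toLinearMap

/-- `Ad_h : 𝔤 → 𝔤`, the tangent map at the identity of `x ↦ h x h⁻¹`. -/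
noncomputable def Ad (h : G) : LieAlg E G →ₗ[ℝ] LieAlg E G :=
  tangentMap (MulAut.conj h).toMonoidHom

/-- `𝔨 = {X : σ_* X = X}`. -/
noncomputable def kSpace (σ : G →* G) : Submodule ℝ (LieAlg E G) :=
  LinearMap.eqLocus (tangentMap σ) LinearMap.id

/-- `𝔭 = {X : σ_* X = -X}`. -/
noncomputable def pSpace (σ : G →* G) : Submodule ℝ (LieAlg E G) :=
  LinearMap.eqLocus (tangentMap σ) (-LinearMap.id)

/-- The projection of `𝔤 = 𝔭 ⊕ 𝔨` onto `𝔨` (for an involution `σ`). -/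
noncomputable def kPart (σ : G →* G) (X : LieAlg E G) : LieAlg E G :=
  (2⁻¹ : ℝ) • (X + tangentMap σ X)

/-- The projection of `𝔤 = 𝔭 ⊕ 𝔨` onto `𝔭` (for an involution `σ`). -/
noncomputable def pPart (σ : G →* G) (X : LieAlg E G) : LieAlg E G :=
  (2⁻¹ : ℝ) • (X - tangentMap σ X)

theorem kPart_add_pPart (σ : G →* G) (X : LieAlg E G) : kPart σ X + pPart σ X = X := by
  unfold kPart pPart
  module

variable [FiniteDimensional ℝ E] [LieGroup 𝓘(ℝ, E) ∞ G]

/-- The form `⟨X, Y⟩ = c · Tr(ad X ∘ ad Y)`, a scalar multiple of the Killing form. -/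
noncomputable def form (c : ℝ) (X Y : LieAlg E G) : ℝ :=
  c * killingForm ℝ (LieAlg E G) X Y

/-- The covector `l = ⟨L, ·⟩` which is identified with `L ∈ 𝔤`. -/
noncomputable def covector (c : ℝ) (L : LieAlg E G) : Module.Dual ℝ (LieAlg E G) :=
  c • killingForm ℝ (LieAlg E G) L

/-- `X ∈ 𝔭` is regular if `{B ∈ 𝔭 : [X, B] = 0}` is abelian. -/
def IsRegular (σ : G →* G) (X : LieAlg E G) : Prop :=
  X ∈ pSpace σ ∧ ∀ B ∈ pSpace (E := E) σ, ∀ C ∈ pSpace (E := E) σ, ⁅X, B⁆ = 0 → ⁅X, C⁆ = 0 → ⁅B, C⁆ = 0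

/-- The bracket `[A₁ + B₁, A₂ + B₂]_s = [B₁, A₂] - [B₂, A₁] + [B₁, B₂] + s [A₁, A₂]` for `Aᵢ ∈ 𝔭`,
`Bᵢ ∈ 𝔨`: the bracket of `𝔤` if `s = 1`, that of the semidirect product `𝔭 ⋊ 𝔨` if `s = 0`. -/
noncomputable def deformedBracket (σ : G →* G) (s : ℝ) (X Y : LieAlg E G) : LieAlg E G :=
  ⁅kPart σ X, pPart σ Y⁆ - ⁅kPart σ Y, pPart σ X⁆ + ⁅kPart σ X, kPart σ Y⁆
    + s • ⁅pPart σ X, pPart σ Y⁆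

theorem deformedBracket_one (σ : G →* G) (X Y : LieAlg E G) :
    deformedBracket σ 1 X Y = ⁅X, Y⁆ := by
  conv_rhs => rw [← kPart_add_pPart σ X, ← kPart_add_pPart σ Y]
  rw [deformedBracket, add_lie, lie_add, lie_add, ← lie_skew (pPart σ X) (kPart σ Y), one_smul]
  abel

/-- Controls: bounded measurable functions on `[0, T]` with values in `𝔨`. -/
structure IsControl (σ : G →* G) (c T : ℝ) (U : ℝ → LieAlg E G) : Prop where
  mem : ∀ t ∈ Icc 0 T, U t ∈ kSpace σ
  measurable : AEStronglyMeasurable U (volume.restrict (Icc 0 T))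
  bounded : ∃ C : ℝ, ∀ t ∈ Icc 0 T, form c (U t) (U t) ≤ C

/-- The cost `½ ∫₀ᵀ ⟨U, U⟩ dt`. -/
noncomputable def cost (c T : ℝ) (U : ℝ → LieAlg E G) : ℝ :=
  (1 / 2) * ∫ t in (0 : ℝ)..T, form c (U t) (U t)

/-- `g` is an absolutely continuous curve on `[0, T]` in `G` with `dg/dt = g (A + U)` almost
everywhere. Absolute continuity of the manifold-valued curve is tested on smooth functions; the
value at `g` of the left-invariant field `g X` is `mulInvariantVectorField X g`. -/
structure IsSolution (T : ℝ) (A : LieAlg E G) (g : ℝ → G) (U : ℝ → LieAlg E G) : Prop where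
  continuousOn : ContinuousOn g (Icc 0 T)
  absolutelyContinuous : ∀ f : G → ℝ, ContMDiff 𝓘(ℝ, E) 𝓘(ℝ, ℝ) ∞ f →
    AbsolutelyContinuousOnInterval (fun t => f (g t)) 0 T
  derivative : ∀ᵐ t ∂volume.restrict (Icc 0 T),
    HasMFDerivAt 𝓘(ℝ, ℝ) 𝓘(ℝ, E) g t
      ((1 : ℝ →L[ℝ] ℝ).smulRight
        (mulInvariantVectorField (I := 𝓘(ℝ, E)) (A + U t) (g t)))

/-- A trajectory on `[0, T]` of the affine system `dg/dt = g (A + U)`, `U ∈ 𝔨`, on `G`. -/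
structure IsTrajectory (σ : G →* G) (c T : ℝ) (A : LieAlg E G) (g : ℝ → G)
    (U : ℝ → LieAlg E G) : Prop where
  control : IsControl σ c T U
  solution : IsSolution T A g U

/-- A trajectory `(x, h)` on `[0, T]` of `dg/dt = g (A + U)`, `U ∈ 𝔨`, on the semidirect product
`G_s = 𝔭 ⋊ K` with `(x₁, h₁)(x₂, h₂) = (x₁ + Ad_{h₁} x₂, h₁ h₂)`, where `K` is the group of fixed
points of `σ`; in components, `dx/dt = Ad_h A` and `dh/dt = h U`. -/
structure IsShadowTrajectory (σ : G →* G) (c T : ℝ) (A : LieAlg E G) (x : ℝ → LieAlg E G)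
    (h : ℝ → G) (U : ℝ → LieAlg E G) : Prop where
  control : IsControl σ c T U
  mem_p : ∀ t ∈ Icc 0 T, x t ∈ pSpace σ
  mem_K : ∀ t ∈ Icc 0 T, σ (h t) = h t
  solution_h : IsSolution T 0 h U
  absolutelyContinuous_x : ∀ φ : Module.Dual ℝ (LieAlg E G),
    AbsolutelyContinuousOnInterval (fun t => φ (x t)) 0 T
  derivative_x : ∀ φ : Module.Dual ℝ (LieAlg E G), ∀ᵐ t ∂volume.restrict (Icc 0 T),
    HasDerivAt (fun τ => φ (x τ)) (φ (Ad (h t) A)) t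

/-- The trajectory `g` with control `U` is optimal relative to its end points `g 0`, `g T`. -/
def IsOptimal (σ : G →* G) (c T : ℝ) (A : LieAlg E G) (g : ℝ → G) (U : ℝ → LieAlg E G) : Prop :=
  IsTrajectory σ c T A g U ∧
    ∀ (g' : ℝ → G) (U' : ℝ → LieAlg E G), IsTrajectory σ c T A g' U' →
      g' 0 = g 0 → g' T = g T → cost c T U ≤ cost c T U'

/-- Optimality of a trajectory `(x, h)` of the affine system on `𝔭 ⋊ K`. -/
def IsShadowOptimal (σ : G →* G) (c T : ℝ) (A : LieAlg E G) (x : ℝ → LieAlg E G) (h : ℝ → G)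
    (U : ℝ → LieAlg E G) : Prop :=
  IsShadowTrajectory σ c T A x h U ∧
    ∀ (x' : ℝ → LieAlg E G) (h' : ℝ → G) (U' : ℝ → LieAlg E G),
      IsShadowTrajectory σ c T A x' h' U' →
      x' 0 = x 0 → h' 0 = h 0 → x' T = x T → h' T = h T → cost c T U ≤ cost c T U'

/-- The Hamiltonian `H_U(λ, l) = λ ½ ‖U‖² + l (A + U)` of the cost-extended system. -/
noncomputable def hamiltonian (c : ℝ) (A : LieAlg E G) (lam : ℝ) (U : LieAlg E G)
    (l : Module.Dual ℝ (LieAlg E G)) : ℝ :=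
  lam * ((1 / 2) * form c U U) + l (A + U)

/-- The conditions of the Maximum Principle on `λ` and on the curve `l(t)` in the dual of `𝔤`, along
the control `U`: the equation `dl/dt = ε l ∘ ad(A + U)`, the sign and nontriviality conditions and
the maximality condition. The bracket is that of `𝔤` for `s = 1` and that of `𝔭 ⋊ 𝔨` for `s = 0`.
The sign `ε = ±1` accounts for the two conventions for the bracket: `ε = 1` gives the Hamiltonian
flow for the bracket of left-invariant vector fields with `[X, Y] = X Y - Y X`, and `ε = -1` for the
opposite bracket. -/
structure IsExtremalLift (σ : G →* G) (c ε s T : ℝ) (A : LieAlg E G) (lam : ℝ)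
    (l : ℝ → Module.Dual ℝ (LieAlg E G)) (U : ℝ → LieAlg E G) : Prop where
  absolutelyContinuous : ∀ X : LieAlg E G, AbsolutelyContinuousOnInterval (fun t => l t X) 0 T
  derivative : ∀ X : LieAlg E G, ∀ᵐ t ∂volume.restrict (Icc 0 T),
    HasDerivAt (fun τ => l τ X) (ε * l t (deformedBracket σ s (A + U t) X)) t
  nonpos : lam ≤ 0
  nontrivial : lam = 0 → ∀ t ∈ Icc 0 T, l t ≠ 0
  maximal : ∀ᵐ t ∂volume.restrict (Icc 0 T), ∀ V ∈ kSpace (E := E) σ,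
    hamiltonian c A lam V (l t) ≤ hamiltonian c A lam (U t) (l t)

/-- Abnormal extremal curves `(g, l)` of the affine problem on `G`: the case `λ = 0`. -/
def IsAbnormalExtremal (σ : G →* G) (c ε T : ℝ) (A : LieAlg E G) (g : ℝ → G)
    (l : ℝ → Module.Dual ℝ (LieAlg E G)) (U : ℝ → LieAlg E G) : Prop :=
  IsTrajectory σ c T A g U ∧ IsExtremalLift σ c ε 1 T A 0 l U

/-- Normal extremal curves `(g, l)` of the affine problem on `G`: the case `λ < 0`, normalized to
`λ = -1` by homogeneity. -/
def IsNormalExtremal (σ : G →* G) (c ε T : ℝ) (A : LieAlg E G) (g : ℝ → G)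
    (l : ℝ → Module.Dual ℝ (LieAlg E G)) (U : ℝ → LieAlg E G) : Prop :=
  IsTrajectory σ c T A g U ∧ IsExtremalLift σ c ε 1 T A (-1) l U

/-- Abnormal extremal curves of the affine problem on `𝔭 ⋊ K`. -/
def IsShadowAbnormalExtremal (σ : G →* G) (c ε T : ℝ) (A : LieAlg E G) (x : ℝ → LieAlg E G)
    (h : ℝ → G) (l : ℝ → Module.Dual ℝ (LieAlg E G)) (U : ℝ → LieAlg E G) : Prop :=
  IsShadowTrajectory σ c T A x h U ∧ IsExtremalLift σ c ε 0 T A 0 l U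

/-- Normal extremal curves of the affine problem on `𝔭 ⋊ K`. -/
def IsShadowNormalExtremal (σ : G →* G) (c ε T : ℝ) (A : LieAlg E G) (x : ℝ → LieAlg E G)
    (h : ℝ → G) (l : ℝ → Module.Dual ℝ (LieAlg E G)) (U : ℝ → LieAlg E G) : Prop :=
  IsShadowTrajectory σ c T A x h U ∧ IsExtremalLift σ c ε 0 T A (-1) l U

/-- The constraints on the control of an abnormal extremal: `l(t) = ⟨L, ·⟩` for the constant
`L ∈ 𝔭`, with `[A, L] = 0` and `[L, U(t)] = 0` for almost all `t`. -/
structure AbnormalConstraints (σ : G →* G) (c T : ℝ) (A L : LieAlg E G)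
    (l : ℝ → Module.Dual ℝ (LieAlg E G)) (U : ℝ → LieAlg E G) : Prop where
  mem : L ∈ pSpace σ
  lift_eq : ∀ t ∈ Icc 0 T, l t = covector c L
  lie_A : ⁅A, L⁆ = 0
  lie_U : ∀ᵐ t ∂volume.restrict (Icc 0 T), ⁅L, U t⁆ = 0

/-- The control is (almost everywhere) a constant element of `𝔨` that commutes with `A`. -/
def IsConstantCommuting (σ : G →* G) (T : ℝ) (A : LieAlg E G) (U : ℝ → LieAlg E G) : Prop :=
  ∃ U₀ ∈ kSpace σ, ⁅A, U₀⁆ = 0 ∧ ∀ᵐ t ∂volume.restrict (Icc 0 T), U t = U₀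

end

end AffineKilling

/-! The form `⟨·,·⟩` is definite on `𝔨` but may be indefinite on `𝔭`, since compact and noncompact
factors can occur together. The key is that it is nevertheless nondegenerate on the centralizer in
`𝔭` of every element of `𝔭`. Averaging over the compact group `K` gives a positive definite form
invariant under `K` and `σ`. It equals `⟨S·,·⟩` for a symmetric operator `S` that commutes with `ad
𝔨` and preserves `𝔭`. Invariance gives `[Sx, y] = [x, Sy]` on `𝔭`, hence `S` preserves the
centralizer of `A` in `𝔭`; an `X` there that is orthogonal to this centralizer has `⟨X, SX⟩ = 0`, so
`X = 0` (`eq_zero_of_commutes_of_orthogonal`, `IsCompactPair.eq_zero_of_centralizer`).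

Abnormal extremals. For `λ = 0` the Hamiltonian is affine in the control, so maximality forces `l =
⟨L, ·⟩` to vanish on `𝔨`, that is, `L(t) ∈ 𝔭`. The `𝔨`-part of the equation for `l` gives `[A, L] =
0`. Since `A` is regular, `L` commutes with the whole centralizer of `A` in `𝔭`, so `L` has zero
derivative when paired with this centralizer. As `L` lies in it, nondegeneracy makes `L` constant,
and what remains of the equation is `[L, U] = 0`. For `L ∈ 𝔭` the two brackets act in the same way
(`IsCompactPair.form_deformedBracket`), which settles the shadow problem together with the original
one.

Optimal abnormal curves. If `L` is regular, nondegeneracy on its centralizer turns `[L, U] = 0` into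
`[A, U] = 0`. For `X ∈ 𝔨` commuting with `A`, the curves `g(t) exp(φ(t) X)` with `φ(0) = φ(T) = 0`
are competing trajectories, and the cost changes by `½ ∫ (2 φ' ⟨U, X⟩ + φ'² ⟨X, X⟩)`. The du
Bois-Reymond lemma makes `⟨U, X⟩` constant. Since `U` itself is such an element and the form is
definite on `𝔨`, `U` is a constant `U₀`, and the constant covector `⟨U₀, ·⟩` is a normal lift.

The variations and the averaging need one-parameter subgroups and the identity `d Ad = ad` for the
bracket defined by left-invariant fields. -/

namespace AffineKilling

/-! ### Linear algebra: nondegeneracy on centralizers -/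

/-- In the `-1`-eigenspace `p` of an orthogonal symmetric pair, an invariant form is nondegenerate on
the centralizer of any element: it is enough that it is related to an invariant positive definite
form by a symmetric operator `S`. -/
theorem eq_zero_of_commutes_of_orthogonal {L : Type*} [LieRing L] [LieAlgebra ℝ L]
    (κ : L →ₗ[ℝ] L →ₗ[ℝ] ℝ) (hinv : ∀ x y z, κ ⁅x, y⁆ z = κ x ⁅y, z⁆)
    (k p : Submodule ℝ L) (hk : ∀ x ∈ k, x ≠ 0 → 0 < κ x x)
    (hpp : ∀ x ∈ p, ∀ y ∈ p, ⁅x, y⁆ ∈ k)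
    (S : L →ₗ[ℝ] L) (hSp : ∀ x ∈ p, S x ∈ p)
    (hS : ∀ x y, κ (S x) y = κ x (S y)) (hpos : ∀ x, x ≠ 0 → 0 < κ x (S x))
    (hSk : ∀ z ∈ k, ∀ x, S ⁅x, z⁆ = ⁅S x, z⁆)
    {A X : L} (hA : A ∈ p) (hX : X ∈ p) (hAX : ⁅A, X⁆ = 0)
    (horth : ∀ Y ∈ p, ⁅A, Y⁆ = 0 → κ X Y = 0) : X = 0 := by
  have hzero : ∀ x ∈ k, κ x x = 0 → x = 0 := fun x hx h => by
    by_contra hne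
    exact (hk x hx hne).ne' h
  -- The difference lies in `k`, where `κ` is definite, so it is enough to pair with `D ∈ k`; there
  -- invariance, symmetry of `S` and its commutation with `ad D` apply.
  have hmove : ∀ x ∈ p, ∀ y ∈ p, ⁅S x, y⁆ = ⁅x, S y⁆ := by
    intro x hx y hy
    have hD : ⁅S x, y⁆ - ⁅x, S y⁆ ∈ k := k.sub_mem (hpp _ (hSp x hx) _ hy) (hpp _ hx _ (hSp y hy))
    have key : ∀ D ∈ k, κ ⁅S x, y⁆ D = κ ⁅x, S y⁆ D := fun D hD => by
      rw [hinv, hS, hSk D hD, ← hinv]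
    refine sub_eq_zero.1 (hzero _ hD ?_)
    rw [map_sub κ, LinearMap.sub_apply, key _ hD, sub_self]
  have hSA : ⁅S A, A⁆ = 0 := by
    have h := hmove A hA A hA
    rw [← lie_skew] at h
    have h2 : (2 : ℝ) • ⁅A, S A⁆ = 0 := by
      rw [two_smul]
      nth_rewrite 1 [← h]
      exact neg_add_cancel _
    rw [← lie_skew, (smul_eq_zero.1 h2).resolve_left two_ne_zero, neg_zero]
  -- Jacobi applied to `[A, SX] = [SA, X]`, as `A` commutes with both `SA` and `X`. Invariance then
  -- gives `κ([A, SX], [A, SX]) = κ([[A, SX], A], SX) = 0`.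
  have hW : ⁅⁅A, S X⁆, A⁆ = 0 := by
    rw [← hmove A hA X hX, lie_lie, hSA, ← lie_skew X A, hAX]
    simp
  have hASX : ⁅A, S X⁆ = 0 :=
    hzero _ (hpp _ hA _ (hSp _ hX)) (by rw [← hinv, hW, map_zero, LinearMap.zero_apply])
  by_contra hne
  exact (hpos X hne).ne' (horth _ (hSp X hX) hASX)

/-- In the `-1`-eigenspace of an involution `θ` of a Lie algebra, an invariant form is nondegenerate
on the centralizer of any element if it is definite on the fixed points of `θ` and there is a
positive definite form which is invariant under `θ` and under the fixed points of `θ`. -/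
theorem eq_zero_of_commutes_of_orthogonal_of_posDef {L : Type*} [LieRing L] [LieAlgebra ℝ L]
    [FiniteDimensional ℝ L]
    (κ : L →ₗ[ℝ] L →ₗ[ℝ] ℝ) (hinv : ∀ x y z, κ ⁅x, y⁆ z = κ x ⁅y, z⁆)
    (hsymm : ∀ x y, κ x y = κ y x) (hnd : ∀ x, (∀ y, κ x y = 0) → x = 0)
    (θ : L →ₗ[ℝ] L) (hθθ : ∀ x, θ (θ x) = x) (hθ : ∀ x y, θ ⁅x, y⁆ = ⁅θ x, θ y⁆)
    (hκθ : ∀ x y, κ (θ x) (θ y) = κ x y)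
    (hk : ∀ x, θ x = x → x ≠ 0 → 0 < κ x x)
    (B : L →ₗ[ℝ] L →ₗ[ℝ] ℝ) (hBsymm : ∀ x y, B x y = B y x) (hBpos : ∀ x, x ≠ 0 → 0 < B x x)
    (hBθ : ∀ x y, B (θ x) (θ y) = B x y)
    (hBk : ∀ z, θ z = z → ∀ x y, B ⁅z, x⁆ y + B x ⁅z, y⁆ = 0)
    {A X : L} (hA : θ A = -A) (hX : θ X = -X) (hAX : ⁅A, X⁆ = 0)
    (horth : ∀ Y, θ Y = -Y → ⁅A, Y⁆ = 0 → κ X Y = 0) : X = 0 := by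
  have hinj : Function.Injective κ := by
    refine (injective_iff_map_eq_zero κ).2 fun x hx => hnd x fun y => ?_
    rw [hx, LinearMap.zero_apply]
  -- `κ` identifies `L` with its dual, and `S` is the operator representing `B` with respect to `κ`.
  let e : L ≃ₗ[ℝ] (L →ₗ[ℝ] ℝ) :=
    LinearEquiv.ofInjectiveOfFinrankEq κ hinj (Subspace.dual_finrank_eq).symm
  let S : L →ₗ[ℝ] L := e.symm.toLinearMap ∘ₗ B
  have hSB : ∀ x y, κ (S x) y = B x y := fun x y =>
    LinearMap.congr_fun (e.apply_symm_apply (B x)) y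
  have hext : ∀ x y, (∀ z, κ x z = κ y z) → x = y := fun x y h => by
    refine sub_eq_zero.1 (hnd _ fun z => ?_)
    rw [map_sub, LinearMap.sub_apply, h, sub_self]
  have hSθ : ∀ x, S (θ x) = θ (S x) := fun x => hext _ _ fun z => by
    rw [hSB, ← hκθ (θ (S x)), hθθ, hSB, ← hBθ, hθθ]
  refine eq_zero_of_commutes_of_orthogonal κ hinv (LinearMap.eqLocus θ LinearMap.id)
    (LinearMap.eqLocus θ (-LinearMap.id)) (fun x hx => hk x hx) ?_ S ?_ ?_ ?_ ?_ hA hX hAX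
    (fun Y hY => horth Y hY)
  · intro x hx y hy
    have hx : θ x = -x := hx
    have hy : θ y = -y := hy
    show θ _ = _
    rw [hθ, hx, hy, neg_lie, lie_neg, neg_neg, LinearMap.id_apply]
  · intro x hx
    have hx : θ x = -x := hx
    show θ _ = -_
    rw [← hSθ, hx, map_neg, LinearMap.id_apply]
  · intro x y
    rw [hSB, hBsymm, ← hSB, hsymm]
  · intro x hx
    rw [hsymm, hSB]
    exact hBpos x hx
  · intro z hz x
    refine hext _ _ fun y => ?_
    rw [hinv, hSB, hSB, ← lie_skew, map_neg, LinearMap.neg_apply]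
    linarith [hBk z hz x y]

/-! ### Invariant vector fields and the adjoint representation -/

section

variable {E F F' : Type*} [NormedAddCommGroup E] [NormedSpace ℝ E]
  [NormedAddCommGroup F] [NormedSpace ℝ F] [NormedAddCommGroup F'] [NormedSpace ℝ F']
  {M : Type*} [TopologicalSpace M] [ChartedSpace E M]
  {N : Type*} [TopologicalSpace N] [ChartedSpace F N]
  {N' : Type*} [TopologicalSpace N'] [ChartedSpace F' N']

/-- The derivative of a map of manifolds as a linear map of the model spaces. -/
noncomputable def tderiv (E F : Type*) [NormedAddCommGroup E] [NormedSpace ℝ E]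
    [NormedAddCommGroup F] [NormedSpace ℝ F]
    {M : Type*} [TopologicalSpace M] [ChartedSpace E M]
    {N : Type*} [TopologicalSpace N] [ChartedSpace F N]
    (f : M → N) (x : M) : E →L[ℝ] F :=
  mfderiv 𝓘(ℝ, E) 𝓘(ℝ, F) f x

theorem tderiv_comp {g : N → N'} {f : M → N} {x : M}
    (hg : MDifferentiableAt 𝓘(ℝ, F) 𝓘(ℝ, F') g (f x))
    (hf : MDifferentiableAt 𝓘(ℝ, E) 𝓘(ℝ, F) f x) (v : E) :
    tderiv E F' (g ∘ f) x v = tderiv F F' g (f x) (tderiv E F f x v) :=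
  mfderiv_comp_apply x hg hf v

theorem tderiv_id (x : M) (v : E) : tderiv E E (id : M → M) x v = v := by
  have h := mfderiv_id (I := 𝓘(ℝ, E)) (x := x)
  exact DFunLike.congr_fun h v

end

section

variable {E : Type*} [NormedAddCommGroup E] [NormedSpace ℝ E]
  {G : Type*} [TopologicalSpace G] [ChartedSpace E G] [Group G]

/-- The left-invariant vector field with value `X` at the identity. -/
noncomputable def leftField (X : E) (g : G) : E := tderiv E E (g * ·) (1 : G) X

/-- The right-invariant vector field with value `X` at the identity. -/
noncomputable def rightField (X : E) (g : G) : E := tderiv E E (· * g) (1 : G) X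

/-- `Ad` as a map to the continuous endomorphisms of the model space. -/
noncomputable def AdL (E : Type*) [NormedAddCommGroup E] [NormedSpace ℝ E]
    {G : Type*} [TopologicalSpace G] [ChartedSpace E G] [Group G] (h : G) : E →L[ℝ] E :=
  tderiv E E (MulAut.conj h).toMonoidHom (1 : G)

variable [LieGroup 𝓘(ℝ, E) ∞ G]

theorem mdifferentiable_mul_left (g : G) : MDifferentiable 𝓘(ℝ, E) 𝓘(ℝ, E) (g * ·) :=
  (contMDiff_mul_left (n := ∞)).mdifferentiable (by simp)

theorem mdifferentiable_mul_right (g : G) : MDifferentiable 𝓘(ℝ, E) 𝓘(ℝ, E) (· * g) :=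
  (contMDiff_mul_right (n := ∞)).mdifferentiable (by simp)

theorem contMDiff_conj (h : G) : ContMDiff 𝓘(ℝ, E) 𝓘(ℝ, E) ∞ (MulAut.conj h).toMonoidHom :=
  (contMDiff_mul_right (a := h⁻¹)).comp (contMDiff_mul_left (a := h))

theorem mdifferentiable_conj (h : G) :
    MDifferentiable 𝓘(ℝ, E) 𝓘(ℝ, E) (MulAut.conj h).toMonoidHom :=
  (contMDiff_conj h).mdifferentiable (by simp)

omit [LieGroup 𝓘(ℝ, E) ∞ G] in
theorem leftField_one (X : E) : leftField X (1 : G) = X := by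
  have : ((1 : G) * ·) = id := by ext; simp
  rw [leftField, this, tderiv_id]

theorem tderiv_mul_left_leftField (g h : G) (X : E) :
    tderiv E E (g * ·) h (leftField X h) = leftField X (g * h) := by
  have h1 := tderiv_comp (x := (1 : G)) (mdifferentiable_mul_left (E := E) g (h * 1))
    (mdifferentiable_mul_left (E := E) h 1) X
  have h2 : (g * ·) ∘ (h * ·) = (g * h * ·) := by ext x; simp [mul_assoc]
  rw [h2, mul_one] at h1
  exact h1.symm

/-- Homomorphisms map left-invariant fields to left-invariant fields. -/
theorem tderiv_leftField (σ : G →* G) (hs : MDifferentiable 𝓘(ℝ, E) 𝓘(ℝ, E) σ) (h : G) (X : E) :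
    tderiv E E σ h (leftField X h) = leftField (tderiv E E σ 1 X) (σ h) := by
  have h1 := tderiv_comp (x := (1 : G)) (hs (h * 1)) (mdifferentiable_mul_left (E := E) h 1) X
  have h2 := tderiv_comp (x := (1 : G)) (mdifferentiable_mul_left (E := E) (σ h) (σ 1)) (hs 1) X
  have h3 : σ ∘ (h * ·) = (σ h * ·) ∘ σ := by ext x; simp
  rw [h3, h2, map_one, mul_one] at h1
  exact h1.symm

theorem AdL_mul (g h : G) (X : E) : AdL E (g * h) X = AdL E g (AdL E h X) := by
  have h1 := tderiv_comp (x := (1 : G)) (mdifferentiable_conj (E := E) g (MulAut.conj h 1))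
    (mdifferentiable_conj (E := E) h 1) X
  have h2 : (MulAut.conj g).toMonoidHom ∘ (MulAut.conj h).toMonoidHom =
      (MulAut.conj (g * h)).toMonoidHom := by
    ext x; simp
  have h3 : MulAut.conj h (1 : G) = 1 := map_one _
  rw [h3] at h1
  rw [AdL, ← h2]
  exact h1

omit [LieGroup 𝓘(ℝ, E) ∞ G] in
theorem AdL_one (X : E) : AdL E (1 : G) X = X := by
  have : ((MulAut.conj (1 : G)).toMonoidHom : G → G) = id := by ext; simp
  rw [AdL, this, tderiv_id]

theorem AdL_inv_AdL (h : G) (X : E) : AdL E h⁻¹ (AdL E h X) = X := by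
  rw [← AdL_mul, inv_mul_cancel, AdL_one]

theorem AdL_AdL_inv (h : G) (X : E) : AdL E h (AdL E h⁻¹ X) = X := by
  rw [← AdL_mul, mul_inv_cancel, AdL_one]

theorem rightField_AdL (g : G) (X : E) : rightField (AdL E g X) g = leftField X g := by
  have h1 := tderiv_comp (x := (1 : G)) (mdifferentiable_mul_right (E := E) g
    ((MulAut.conj g).toMonoidHom 1)) (mdifferentiable_conj (E := E) g 1) X
  have h2 : (· * g) ∘ (MulAut.conj g).toMonoidHom = (g * ·) := by ext x; simp
  rw [h2, map_one] at h1
  exact h1.symm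

theorem tderiv_mul_right_leftField (g h : G) (X : E) :
    tderiv E E (· * h) g (leftField X g) = leftField (AdL E h⁻¹ X) (g * h) := by
  have h1 := tderiv_comp (x := (1 : G)) (mdifferentiable_mul_right (E := E) h (g * 1))
    (mdifferentiable_mul_left (E := E) g 1) X
  have h2 := tderiv_comp (x := (1 : G)) (mdifferentiable_mul_left (E := E) (g * h)
    ((MulAut.conj h⁻¹).toMonoidHom 1)) (mdifferentiable_conj (E := E) h⁻¹ 1) X
  have h3 : (· * h) ∘ (g * ·) = (g * h * ·) ∘ (MulAut.conj h⁻¹).toMonoidHom := by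
    ext x; simp [mul_assoc]
  rw [h3, h2, map_one, mul_one] at h1
  exact h1.symm

theorem tderiv_AdL (σ : G →* G) (hs : MDifferentiable 𝓘(ℝ, E) 𝓘(ℝ, E) σ) (h : G) (X : E) :
    tderiv E E σ 1 (AdL E h X) = AdL E (σ h) (tderiv E E σ 1 X) := by
  have h1 := tderiv_comp (x := (1 : G)) (hs ((MulAut.conj h).toMonoidHom 1))
    (mdifferentiable_conj (E := E) h 1) X
  have h2 := tderiv_comp (x := (1 : G)) (mdifferentiable_conj (E := E) (σ h) (σ 1)) (hs 1) X
  have h3 : σ ∘ (MulAut.conj h).toMonoidHom = (MulAut.conj (σ h)).toMonoidHom ∘ σ := by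
    ext x; simp
  rw [h3, h2, map_one, map_one] at h1
  exact h1.symm

/-- Both base points are fixed, so the coordinate changes are trivial. Smoothness of a family of
differentials at the identity thus becomes smoothness of a map into a fixed space of operators. -/
theorem inTangentCoordinates_const {y : G} {g : G → G} (hg : ∀ x, g x = y) (ϕ : G → E →L[ℝ] E)
    (x₀ : G) :
    inTangentCoordinates 𝓘(ℝ, E) 𝓘(ℝ, E) (fun _ => y) g ϕ x₀ = ϕ := by
  have : IsManifold 𝓘(ℝ, E) 1 G := IsManifold.of_le (n := ∞) (by simp)
  obtain rfl : g = fun _ => y := funext hg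
  ext x v
  rw [inTangentCoordinates_eq _ _ _ (mem_chart_source E y) (mem_chart_source E y)]
  have hc : ∀ w : E, (tangentBundleCore 𝓘(ℝ, E) G).coordChange (achart E y) (achart E y) y w = w :=
    fun w => tangentCoordChange_self (mem_extChartAt_source y)
  rw [ContinuousLinearMap.comp_apply, ContinuousLinearMap.comp_apply, hc, hc]

/-- `Ad x` is the partial derivative at `y = 1` of the jointly smooth map `(x, y) ↦ x y x⁻¹`. -/
theorem contMDiff_AdL :
    ContMDiff 𝓘(ℝ, E) 𝓘(ℝ, E →L[ℝ] E) ∞ (AdL E : G → E →L[ℝ] E) := by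
  intro x₀
  have hf : ContMDiffAt (𝓘(ℝ, E).prod 𝓘(ℝ, E)) 𝓘(ℝ, E) ∞
      (Function.uncurry fun (x : G) (y : G) => (MulAut.conj x).toMonoidHom y) (x₀, (1 : G)) := by
    have : ContMDiff (𝓘(ℝ, E).prod 𝓘(ℝ, E)) 𝓘(ℝ, E) ∞
        (fun z : G × G => z.1 * z.2 * z.1⁻¹) :=
      (contMDiff_fst.mul contMDiff_snd).mul contMDiff_fst.inv
    exact this _
  have : IsManifold 𝓘(ℝ, E) 1 G := IsManifold.of_le (n := ∞) (by simp)
  have h := ContMDiffAt.mfderiv (m := ∞) (x₀ := x₀) (fun (x : G) (y : G) => (MulAut.conj x).toMonoidHom y)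
    (fun _ => (1 : G)) hf contMDiffAt_const (by simp)
  exact (inTangentCoordinates_const (g := fun x => (MulAut.conj x).toMonoidHom 1)
    (fun x => map_one _) (AdL E) x₀) ▸ h

end
-- Brackets of invariant fields and the derivative of `Ad`
section

variable {E : Type*} [NormedAddCommGroup E] [NormedSpace ℝ E]
  {G : Type*} [TopologicalSpace G] [ChartedSpace E G] [Group G]

omit [Group G] in
theorem tderiv_inverse {f f' : G → G} (hf : MDifferentiable 𝓘(ℝ, E) 𝓘(ℝ, E) f)
    (hf' : MDifferentiable 𝓘(ℝ, E) 𝓘(ℝ, E) f') (h : ∀ x, f' (f x) = x) (h' : ∀ x, f (f' x) = x)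
    (x : G) : (tderiv E E f x).inverse = tderiv E E f' (f x) := by
  refine ContinuousLinearMap.inverse_eq ?_ ?_ <;> ext v
  · have h1 := tderiv_comp (x := f x) (hf (f' (f x))) (hf' (f x)) v
    have h2 : f ∘ f' = id := funext h'
    rw [h2, tderiv_id, h] at h1
    exact h1.symm
  · have h1 := tderiv_comp (x := x) (hf' (f x)) (hf x) v
    have h2 : f' ∘ f = id := funext h
    rw [h2, tderiv_id] at h1
    exact h1.symm

/-- The Lie bracket of vector fields, given as maps to the model space. -/
noncomputable def fieldBracket (V W : G → E) (x : G) : E :=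
  VectorField.mlieBracket 𝓘(ℝ, E) (M := G) V W x

variable [LieGroup 𝓘(ℝ, E) ∞ G]

/-- A vector field, given as a map to the model space, is differentiable at a point. -/
def MDiffFieldAt (V : G → E) (x : G) : Prop :=
  MDifferentiableAt 𝓘(ℝ, E) 𝓘(ℝ, E).tangent
    (fun y => (⟨y, V y⟩ : TangentBundle 𝓘(ℝ, E) G)) x

theorem mdiffFieldAt_leftField (X : E) (g : G) : MDiffFieldAt (leftField X) g :=
  mdifferentiableAt_mulInvariantVectorField (I := 𝓘(ℝ, E)) (G := G) X

omit [Group G] [LieGroup 𝓘(ℝ, E) ∞ G] in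
theorem fieldBracket_swap (V W : G → E) (x : G) : fieldBracket V W x = - fieldBracket W V x :=
  VectorField.mlieBracket_swap_apply

/-- The Leibniz rule for a combination of fields with function coefficients, the form in which
right-invariant fields are expanded in left-invariant ones. -/
theorem fieldBracket_sum [FiniteDimensional ℝ E] {ι : Type*} (s : Finset ι) (V : G → E) (a : ι → G → ℝ)
    (W : ι → G → E) (x : G)
    (ha : ∀ i, MDifferentiableAt 𝓘(ℝ, E) 𝓘(ℝ, ℝ) (a i) x) (hW : ∀ i, MDiffFieldAt (W i) x) :
    MDiffFieldAt (fun y => ∑ i ∈ s, a i y • W i y) x ∧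
    fieldBracket V (fun y => ∑ i ∈ s, a i y • W i y) x =
      ∑ i ∈ s, (tderiv E ℝ (a i) x (V x) • W i x + a i x • fieldBracket V (W i) x) := by
  have : IsManifold 𝓘(ℝ, E) (minSmoothness ℝ 2) G :=
    IsManifold.of_le (n := minSmoothness ℝ 3) (minSmoothness_monotone (by norm_cast))
  have : IsManifold 𝓘(ℝ, E) 1 G := IsManifold.of_le (n := ∞) (by simp)
  classical
  induction s using Finset.induction_on with
  | empty =>
    refine ⟨?_, ?_⟩
    · simp only [Finset.sum_empty]
      exact (Bundle.contMDiff_zeroSection (n := 1) ℝ (TangentSpace 𝓘(ℝ, E) : G → Type _)).mdifferentiable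
        (by simp) x
    · simp only [Finset.sum_empty]
      exact congrFun (VectorField.mlieBracket_zero_right (I := 𝓘(ℝ, E)) (W := V)) x
  | insert j s hj ih =>
    have h1 : MDiffFieldAt (fun y => a j y • W j y) x := (ha j).smul_section (hW j)
    have h2 : fieldBracket V (fun y => a j y • W j y) x =
        tderiv E ℝ (a j) x (V x) • W j x + a j x • fieldBracket V (W j) x :=
      VectorField.mlieBracket_smul_right (I := 𝓘(ℝ, E)) (V := V) (ha j) (hW j)
    simp only [Finset.sum_insert hj]
    refine ⟨mdifferentiableAt_add_section h1 ih.1, ?_⟩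
    rw [← h2, ← ih.2]
    exact VectorField.mlieBracket_add_right (I := 𝓘(ℝ, E)) (V := V) h1 ih.1

theorem fieldBracket_pullback [FiniteDimensional ℝ E] {f f' : G → G} (hf : ContMDiff 𝓘(ℝ, E) 𝓘(ℝ, E) ∞ f)
    (hf' : ContMDiff 𝓘(ℝ, E) 𝓘(ℝ, E) ∞ f') (h : ∀ x, f' (f x) = x) (h' : ∀ x, f (f' x) = x)
    (V W : G → E) (x : G) (hV : MDiffFieldAt V (f x)) (hW : MDiffFieldAt W (f x)) :
    tderiv E E f' (f x) (fieldBracket V W (f x)) =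
      fieldBracket (fun y => tderiv E E f' (f y) (V (f y)))
        (fun y => tderiv E E f' (f y) (W (f y))) x := by
  have : IsManifold 𝓘(ℝ, E) (minSmoothness ℝ 3) G :=
    inferInstance
  have : IsManifold 𝓘(ℝ, E) (minSmoothness ℝ 2) G :=
    IsManifold.of_le (n := minSmoothness ℝ 3) (minSmoothness_monotone (by norm_cast))
  have h1 := VectorField.mpullback_mlieBracket (I := 𝓘(ℝ, E)) (I' := 𝓘(ℝ, E)) (V := V) (W := W)
    (n := ∞) hV hW hf.contMDiffAt (by
      rw [minSmoothness_of_isRCLikeNormedField]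
      exact ENat.LEInfty.out)
  have h2 := tderiv_inverse (hf.mdifferentiable (by simp)) (hf'.mdifferentiable (by simp)) h h'
  have h3 : ∀ U : G → E, VectorField.mpullback 𝓘(ℝ, E) 𝓘(ℝ, E) f U =
      fun y => tderiv E E f' (f y) (U (f y)) := fun U => by
    funext y
    rw [← h2]
    rfl
  rw [h3, h3] at h1
  rw [← h2]
  exact h1

/-- Pullback by the diffeomorphism `f` respects brackets of fields, and takes left-invariant fields
to left-invariant fields because its inverse `f'` is a homomorphism. -/
theorem tderiv_lie [FiniteDimensional ℝ E] {f f' : G →* G} (hf : ContMDiff 𝓘(ℝ, E) 𝓘(ℝ, E) ∞ f)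
    (hf' : ContMDiff 𝓘(ℝ, E) 𝓘(ℝ, E) ∞ f') (h : ∀ x, f' (f x) = x) (h' : ∀ x, f (f' x) = x)
    (X Y : LieAlg E G) : tangentMap f' ⁅X, Y⁆ = ⁅tangentMap f' X, tangentMap f' Y⁆ := by
  have h0 : ∀ (Z : E) (y : G), tderiv E E f' (f y) (leftField Z (f y)) =
      leftField (tderiv E E f' 1 Z) y := fun Z y => by
    rw [tderiv_leftField f' (hf'.mdifferentiable (by simp)), h]
  have key : ∀ Y Z : E, tderiv E E f' 1 (fieldBracket (leftField Y) (leftField Z) (1 : G)) =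
      fieldBracket (leftField (tderiv E E f' 1 Y)) (leftField (tderiv E E f' 1 Z)) (1 : G) := by
    intro Y Z
    have h1 := fieldBracket_pullback hf hf' h h' (leftField Y) (leftField Z) 1
      (mdiffFieldAt_leftField Y _) (mdiffFieldAt_leftField Z _)
    simp only [h0, map_one] at h1
    exact h1
  exact key X Y

theorem HasMFDerivAt.group_mul {F : Type*} [NormedAddCommGroup F] [NormedSpace ℝ F]
    {M : Type*} [TopologicalSpace M] [ChartedSpace F M] {f g : M → G} {x : M} {f' g' : F →L[ℝ] E}
    (hf : HasMFDerivAt 𝓘(ℝ, F) 𝓘(ℝ, E) f x f') (hg : HasMFDerivAt 𝓘(ℝ, F) 𝓘(ℝ, E) g x g') :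
    HasMFDerivAt 𝓘(ℝ, F) 𝓘(ℝ, E) (fun y => f y * g y) x
      (((tderiv E E (· * g x) (f x)).comp f') + ((tderiv E E (f x * ·) (g x)).comp g')) := by
  have hm : MDifferentiableAt (𝓘(ℝ, E).prod 𝓘(ℝ, E)) 𝓘(ℝ, E) (fun p : G × G => p.1 * p.2)
      (f x, g x) :=
    (contMDiff_mul 𝓘(ℝ, E) ∞).mdifferentiableAt (by simp)
  have h := hm.hasMFDerivAt.comp x (hf.prodMk hg)
  refine h.congr_mfderiv ?_
  ext v
  exact mfderiv_prod_eq_add_apply (v := (f' v, g' v)) hm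

theorem mdifferentiable_inv : MDifferentiable 𝓘(ℝ, E) 𝓘(ℝ, E) (fun x : G => x⁻¹) :=
  (contMDiff_inv 𝓘(ℝ, E) ∞).mdifferentiable (by simp)

theorem tderiv_inv_one (X : E) : tderiv E E (fun x : G => x⁻¹) 1 X = - X := by
  have hi := (mdifferentiable_inv (E := E) (1 : G)).hasMFDerivAt
  have h := HasMFDerivAt.group_mul (hasMFDerivAt_id (I := 𝓘(ℝ, E)) (1 : G)) hi
  have h1 : (fun y : G => id y * y⁻¹) = fun _ => (1 : G) := by ext; simp
  rw [h1] at h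
  have h2 := hasMFDerivAt_unique h (hasMFDerivAt_const (1 : G) (1 : G))
  have h3 : tderiv E E (· * (1 : G)⁻¹) (1 : G) X +
      tderiv E E ((1 : G) * ·) ((1 : G)⁻¹) (tderiv E E (fun x : G => x⁻¹) 1 X) = 0 :=
    DFunLike.congr_fun h2 X
  have h4 : ((1 : G) * ·) = id := by ext; simp
  have h5 : (· * (1 : G)⁻¹) = id := by ext; simp
  rw [h4, h5, tderiv_id, tderiv_id] at h3
  exact (neg_eq_of_add_eq_zero_right h3).symm

/-- The derivative of `Ad` at the identity. -/
noncomputable def adD (G : Type*) [TopologicalSpace G] [ChartedSpace E G] [Group G]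
    (X Y : E) : E := tderiv E (E →L[ℝ] E) (AdL E : G → E →L[ℝ] E) 1 X Y

theorem mdifferentiable_AdL :
    MDifferentiable 𝓘(ℝ, E) 𝓘(ℝ, E →L[ℝ] E) (AdL E : G → E →L[ℝ] E) :=
  contMDiff_AdL.mdifferentiable (by simp)

theorem rightField_eq_leftField (X : E) (g : G) : rightField X g = leftField (AdL E g⁻¹ X) g := by
  rw [← rightField_AdL, AdL_AdL_inv]

theorem tderiv_clm (φ : E →L[ℝ] ℝ) (X Y : E) :
    tderiv E ℝ (fun g : G => φ (AdL E g⁻¹ Y)) 1 X = - φ (adD G X Y) := by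
  let ψ : (E →L[ℝ] E) →L[ℝ] ℝ := φ.comp (ContinuousLinearMap.apply ℝ E Y)
  have h1 := tderiv_comp (x := (1 : G)) (f := fun g : G => g⁻¹) (g := (AdL E : G → E →L[ℝ] E))
    (mdifferentiable_AdL _) (mdifferentiable_inv _) X
  have h2 := tderiv_comp (x := (1 : G)) (f := (AdL E : G → E →L[ℝ] E) ∘ fun g : G => g⁻¹)
    (g := ψ) ψ.differentiableAt.mdifferentiableAt
    ((mdifferentiable_AdL _).comp _ (mdifferentiable_inv _)) X
  rw [h1, tderiv_inv_one, inv_one] at h2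
  have h3 : ∀ z w, tderiv (E →L[ℝ] E) ℝ ψ z w = ψ w := fun z w => by
    rw [tderiv, mfderiv_eq_fderiv, ψ.fderiv]
  rw [h3, map_neg, map_neg] at h2
  exact h2

end
section

variable {E : Type*} [NormedAddCommGroup E] [NormedSpace ℝ E] [FiniteDimensional ℝ E]
  {G : Type*} [TopologicalSpace G] [ChartedSpace E G] [Group G] [LieGroup 𝓘(ℝ, E) ∞ G]

omit [FiniteDimensional ℝ E] in
theorem mdifferentiable_AdL_inv_apply (φ : E →L[ℝ] ℝ) (Y : E) :
    MDifferentiable 𝓘(ℝ, E) 𝓘(ℝ, ℝ) (fun g : G => φ (AdL E g⁻¹ Y)) := by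
  intro x
  let ψ : (E →L[ℝ] E) →L[ℝ] ℝ := φ.comp (ContinuousLinearMap.apply ℝ E Y)
  have h : MDifferentiableAt 𝓘(ℝ, E →L[ℝ] E) 𝓘(ℝ, ℝ) ψ ((AdL E : G → E →L[ℝ] E) x⁻¹) :=
    ψ.differentiableAt.mdifferentiableAt
  have h1 : MDifferentiableAt 𝓘(ℝ, E) 𝓘(ℝ, E →L[ℝ] E)
      ((AdL E : G → E →L[ℝ] E) ∘ fun g : G => g⁻¹) x :=
    (mdifferentiable_AdL _).comp x (mdifferentiable_inv x)
  exact MDifferentiableAt.comp (g := ψ) (f := (AdL E : G → E →L[ℝ] E) ∘ fun g : G => g⁻¹) x h h1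

theorem rightField_eq_sum (Y : E) :
    rightField Y = fun g : G => ∑ i, LinearMap.toContinuousLinearMap
      ((Module.finBasis ℝ E).coord i) (AdL E g⁻¹ Y) • leftField (Module.finBasis ℝ E i) g := by
  funext g
  rw [rightField_eq_leftField]
  conv_lhs => rw [← (Module.finBasis ℝ E).sum_repr (AdL E g⁻¹ Y)]
  simp only [leftField, map_sum, map_smul]
  rfl

theorem mdiffFieldAt_rightField (Y : E) (x : G) : MDiffFieldAt (rightField Y) x := by
  rw [rightField_eq_sum]
  exact (fieldBracket_sum _ 0 _ _ x (fun i => mdifferentiable_AdL_inv_apply _ Y x)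
    (fun i => mdiffFieldAt_leftField _ x)).1

/-- The coefficients of the right-invariant field of `Y` in a left-invariant frame are the
coordinates of `Ad(g⁻¹) Y`. In the Leibniz rule at `1`, their derivatives along `X` produce the term
`-adD G X Y`. -/
theorem fieldBracket_left_right (X Y : E) :
    fieldBracket (leftField X) (rightField Y) (1 : G) =
      fieldBracket (leftField X) (leftField Y) (1 : G) - adD G X Y := by
  have h0 : leftField Y = fun g : G => ∑ i, (Module.finBasis ℝ E).coord i Y •
      leftField (Module.finBasis ℝ E i) g := by
    funext g
    conv_lhs => rw [← (Module.finBasis ℝ E).sum_repr Y]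
    simp only [leftField, map_sum, map_smul]
    rfl
  have h1 := (fieldBracket_sum Finset.univ (leftField X) _ _ (1 : G)
    (fun i => mdifferentiable_AdL_inv_apply (LinearMap.toContinuousLinearMap
      ((Module.finBasis ℝ E).coord i)) Y 1)
    (fun i => mdiffFieldAt_leftField (Module.finBasis ℝ E i) 1)).2
  have h2 := (fieldBracket_sum Finset.univ (leftField X)
    (fun i _ => (Module.finBasis ℝ E).coord i Y) _ (1 : G)
    (fun i => mdifferentiableAt_const)
    (fun i => mdiffFieldAt_leftField (Module.finBasis ℝ E i) 1)).2
  rw [← h0] at h2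
  rw [← rightField_eq_sum] at h1
  have h3 : ∀ (a : ℝ) (v : E), tderiv E ℝ (fun _ : G => a) 1 v = 0 := fun a v => by
    rw [tderiv, mfderiv_const]; rfl
  simp only [h3, zero_smul, zero_add] at h2
  simp only [tderiv_clm, inv_one, AdL_one, leftField_one, Finset.sum_add_distrib] at h1
  rw [h1, h2, add_comm, sub_eq_add_neg]
  congr 1
  conv_rhs => rw [← (Module.finBasis ℝ E).sum_repr (adD G X Y)]
  simp only [neg_smul, Finset.sum_neg_distrib]
  rfl

omit [FiniteDimensional ℝ E] in
theorem tderiv_inv_leftField (X : E) (g : G) :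
    tderiv E E (fun x : G => x⁻¹) g⁻¹ (leftField X g⁻¹) = - rightField X g := by
  have h1 := tderiv_comp (x := (1 : G)) (mdifferentiable_inv (E := E) (g⁻¹ * 1))
    (mdifferentiable_mul_left (E := E) g⁻¹ 1) X
  have h2 := tderiv_comp (x := (1 : G)) (mdifferentiable_mul_right (E := E) g 1⁻¹)
    (mdifferentiable_inv (E := E) 1) X
  have h3 : (fun x : G => x⁻¹) ∘ (g⁻¹ * ·) = (· * g) ∘ fun x : G => x⁻¹ := by
    ext x; simp
  rw [h3, h2, tderiv_inv_one, inv_one, mul_one, map_neg] at h1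
  exact h1.symm

omit [FiniteDimensional ℝ E] in
theorem tderiv_inv_rightField (X : E) (g : G) :
    tderiv E E (fun x : G => x⁻¹) g⁻¹ (rightField X g⁻¹) = - leftField X g := by
  have h1 := tderiv_comp (x := (1 : G)) (mdifferentiable_inv (E := E) (1 * g⁻¹))
    (mdifferentiable_mul_right (E := E) g⁻¹ 1) X
  have h2 := tderiv_comp (x := (1 : G)) (mdifferentiable_mul_left (E := E) g 1⁻¹)
    (mdifferentiable_inv (E := E) 1) X
  have h3 : (fun x : G => x⁻¹) ∘ (· * g⁻¹) = (g * ·) ∘ fun x : G => x⁻¹ := by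
    ext x; simp
  rw [h3, h2, tderiv_inv_one, inv_one, one_mul, map_neg] at h1
  exact h1.symm

theorem fieldBracket_neg_neg (V W : G → E) (x : G) (hV : MDiffFieldAt V x) (hW : MDiffFieldAt W x) :
    fieldBracket (fun y => - V y) (fun y => - W y) x = fieldBracket V W x := by
  have h := fun (V W : G → E) (hW : MDiffFieldAt W x) =>
    (fieldBracket_sum {()} V (fun _ _ => (-1 : ℝ)) (fun _ => W) x
    (fun i => mdifferentiableAt_const) (fun i => hW)).2
  have h3 : ∀ (a : ℝ) (v : E), tderiv E ℝ (fun _ : G => a) x v = 0 := fun a v => by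
    rw [tderiv, mfderiv_const]; rfl
  simp only [h3, zero_smul, zero_add, Finset.sum_singleton, neg_smul, one_smul] at h
  rw [h _ _ hW, fieldBracket_swap, h _ _ hV, neg_neg, ← fieldBracket_swap]

/-- Inversion exchanges left- and right-invariant fields up to sign and has derivative `-1` at the
identity. -/
theorem fieldBracket_left_right_symm (X Y : E) :
    fieldBracket (leftField X) (rightField Y) (1 : G) =
      fieldBracket (leftField Y) (rightField X) (1 : G) := by
  have h1 := fieldBracket_pullback (contMDiff_inv 𝓘(ℝ, E) ∞) (contMDiff_inv 𝓘(ℝ, E) ∞) inv_inv inv_inv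
    (leftField X) (rightField Y) (1 : G) (mdiffFieldAt_leftField X _) (mdiffFieldAt_rightField Y _)
  simp only [tderiv_inv_leftField, tderiv_inv_rightField, inv_one, tderiv_inv_one] at h1
  rw [fieldBracket_neg_neg _ _ _ (mdiffFieldAt_rightField X _) (mdiffFieldAt_leftField Y _),
    fieldBracket_swap (rightField X), neg_inj] at h1
  exact h1

omit [FiniteDimensional ℝ E] [LieGroup 𝓘(ℝ, E) ∞ G] in
theorem adD_add_left (X Y Z : E) : adD G (X + Y) Z = adD G X Z + adD G Y Z := by
  simp [adD]

omit [FiniteDimensional ℝ E] [LieGroup 𝓘(ℝ, E) ∞ G] in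
theorem adD_add_right (X Y Z : E) : adD G X (Y + Z) = adD G X Y + adD G X Z := by
  simp [adD]

/-- The two preceding identities give `2 [X, Y] = adD X Y - adD Y X`, and polarizing `adD X X = 0`
makes `adD` antisymmetric. That left- and right-invariant fields commute is not needed. -/
theorem adD_eq_fieldBracket_of_self (h : ∀ X : E, adD G X X = 0) (X Y : E) :
    adD G X Y = fieldBracket (leftField X) (leftField Y) (1 : G) := by
  have h1 := fieldBracket_left_right_symm (G := G) X Y
  rw [fieldBracket_left_right, fieldBracket_left_right, fieldBracket_swap (leftField Y)] at h1
  have h2 := h (X + Y)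
  rw [adD_add_left, adD_add_right, adD_add_right, h, h, zero_add, add_zero] at h2
  rw [eq_neg_of_add_eq_zero_right h2] at h1
  generalize fieldBracket (leftField X) (leftField Y) (1 : G) = b at *
  generalize adD G X Y = d at *
  have h3 : (2 : ℝ) • (d - b) = 0 := by
    have h4 : d - b = b - d := by rw [h1]; abel
    rw [two_smul]
    nth_rewrite 1 [h4]
    abel
  exact sub_eq_zero.1 ((smul_eq_zero.1 h3).resolve_left two_ne_zero)

end
-- One-parameter subgroups
section

variable {E : Type*} [NormedAddCommGroup E] [NormedSpace ℝ E]
  {G : Type*} [TopologicalSpace G] [ChartedSpace E G] [Group G]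

/-- The curve `e` in `G` is an integral curve of the left-invariant field of `X`, starting at the
identity. -/
structure IsOneParam (X : E) (e : ℝ → G) : Prop where
  zero : e 0 = 1
  curve : IsMIntegralCurve e (mulInvariantVectorField (I := 𝓘(ℝ, E)) (G := G) X)

theorem IsOneParam.hasMFDerivAt {X : E} {e : ℝ → G} (h : IsOneParam X e) (t : ℝ) :
    HasMFDerivAt 𝓘(ℝ, ℝ) 𝓘(ℝ, E) e t ((1 : ℝ →L[ℝ] ℝ).smulRight (leftField X (e t) : E) : ℝ →L[ℝ] E) :=
  h.curve t

variable [LieGroup 𝓘(ℝ, E) ∞ G]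

omit [LieGroup 𝓘(ℝ, E) ∞ G] in
theorem IsMIntegralCurve.comp_hom {X : E} {γ : ℝ → G}
    (hγ : ∀ t, HasMFDerivAt 𝓘(ℝ, ℝ) 𝓘(ℝ, E) γ t ((1 : ℝ →L[ℝ] ℝ).smulRight (leftField X (γ t) : E) :
      ℝ →L[ℝ] E))
    {f : G → G} (hf : MDifferentiable 𝓘(ℝ, E) 𝓘(ℝ, E) f) (Y : E)
    (h : ∀ g, tderiv E E f g (leftField X g) = leftField Y (f g)) :
    IsMIntegralCurve (fun t => f (γ t)) (mulInvariantVectorField (I := 𝓘(ℝ, E)) (G := G) Y) := by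
  intro t
  refine ((hf (γ t)).hasMFDerivAt.comp t (hγ t)).congr_mfderiv ?_
  ext
  show tderiv E E f (γ t) ((1 : ℝ) • leftField X (γ t)) = (1 : ℝ) • leftField Y (f (γ t))
  rw [one_smul, one_smul, h]

variable [FiniteDimensional ℝ E] [T2Space G]

omit [FiniteDimensional ℝ E] [T2Space G] in
theorem contMDiff_field (X : E) : ContMDiff 𝓘(ℝ, E) 𝓘(ℝ, E).tangent 1 (fun g : G =>
    (⟨g, mulInvariantVectorField (I := 𝓘(ℝ, E)) (G := G) X g⟩ : TangentBundle 𝓘(ℝ, E) G)) :=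
  (contMDiff_mulInvariantVectorField (I := 𝓘(ℝ, E)) (G := G) X).of_le (by
    rw [minSmoothness_of_isRCLikeNormedField]; exact one_le_two)

omit [FiniteDimensional ℝ E] in
theorem integralCurve_unique {X : E} {γ γ' : ℝ → G}
    (h : IsMIntegralCurve γ (mulInvariantVectorField (I := 𝓘(ℝ, E)) (G := G) X))
    (h' : IsMIntegralCurve γ' (mulInvariantVectorField (I := 𝓘(ℝ, E)) (G := G) X))
    (h0 : γ 0 = γ' 0) : γ = γ' :=
  isMIntegralCurve_Ioo_eq_of_contMDiff_boundaryless (contMDiff_field X) h h' h0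

variable (G) in
theorem exists_isOneParam (X : E) : ∃ e : ℝ → G, IsOneParam X e := by
  obtain ⟨γ, h0, hγ⟩ := exists_isMIntegralCurveAt_of_contMDiffAt_boundaryless (t₀ := 0)
    (contMDiff_field X (1 : G))
  obtain ⟨ε, hε, h⟩ := (isMIntegralCurveAt_iff' ).1 hγ
  -- Left translates of the local curve at `1` are integral curves on the same interval from every
  -- point; this uniform existence time yields a global curve.
  have h1 : ∀ x : G, ∃ γ : ℝ → G, γ 0 = x ∧
      IsMIntegralCurveOn γ (mulInvariantVectorField (I := 𝓘(ℝ, E)) (G := G) X) (Ioo (-ε) ε) := by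
    intro x
    refine ⟨fun t => x * γ t, by simp [h0], fun t ht => ?_⟩
    rw [Real.ball_eq_Ioo, zero_sub, zero_add] at h
    refine ((mdifferentiable_mul_left x (γ t)).hasMFDerivAt.comp_hasMFDerivWithinAt t
      (h t ht)).congr_mfderiv ?_
    ext
    show tderiv E E (x * ·) (γ t) ((1 : ℝ) • leftField X (γ t)) = (1 : ℝ) • leftField X (x * γ t)
    rw [one_smul, one_smul, tderiv_mul_left_leftField]
  obtain ⟨e, he, hc⟩ := exists_isMIntegralCurve_of_isMIntegralCurveOn (contMDiff_field X) hε h1 1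
  exact ⟨e, he, hc⟩

omit [FiniteDimensional ℝ E] [T2Space G] in
theorem IsOneParam.map {X : E} {e : ℝ → G} (he : IsOneParam X e) (σ : G →* G)
    (hs : MDifferentiable 𝓘(ℝ, E) 𝓘(ℝ, E) σ) : IsOneParam (tderiv E E σ 1 X) (fun t => σ (e t)) :=
  ⟨by simp [he.zero], IsMIntegralCurve.comp_hom he.hasMFDerivAt hs _ fun g => tderiv_leftField σ hs g X⟩

omit [FiniteDimensional ℝ E] in
theorem IsOneParam.unique {X : E} {e e' : ℝ → G} (he : IsOneParam X e) (he' : IsOneParam X e') :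
    e = e' :=
  integralCurve_unique he.curve he'.curve (he.zero.trans he'.zero.symm)

omit [FiniteDimensional ℝ E] in
theorem IsOneParam.add {X : E} {e : ℝ → G} (he : IsOneParam X e) (s t : ℝ) :
    e (s + t) = e s * e t := by
  have h1 : IsMIntegralCurve (fun t => e (t + s))
      (mulInvariantVectorField (I := 𝓘(ℝ, E)) (G := G) X) := he.curve.comp_add s
  have h2 := IsMIntegralCurve.comp_hom he.hasMFDerivAt (mdifferentiable_mul_left (e s)) X
    (fun g => tderiv_mul_left_leftField _ _ X)
  have h3 := integralCurve_unique h1 h2 (by simp [he.zero])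
  rw [add_comm]
  exact congrFun h3 t

-- Conjugation by `e t` fixes the curve `e`, by commutativity, hence fixes its velocity at `0`.
omit [FiniteDimensional ℝ E] in
theorem IsOneParam.AdL_self {X : E} {e : ℝ → G} (he : IsOneParam X e) (t : ℝ) :
    AdL E (e t) X = X := by
  have h1 := he.map (MulAut.conj (e t)).toMonoidHom (mdifferentiable_conj (e t))
  have h2 : (fun s => (MulAut.conj (e t)).toMonoidHom (e s)) = e := by
    funext s
    have : e t * e s = e s * e t := by rw [← he.add, ← he.add, add_comm]
    simp [this]
  rw [h2] at h1
  have h3 := hasMFDerivAt_unique (h1.hasMFDerivAt 0) (he.hasMFDerivAt 0)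
  have h4 : (1 : ℝ) • leftField (AdL E (e t) X) (e 0) = (1 : ℝ) • leftField X (e 0) :=
    DFunLike.congr_fun h3 1
  rwa [one_smul, one_smul, he.zero, leftField_one, leftField_one] at h4

omit [FiniteDimensional ℝ E] [T2Space G] in
theorem IsOneParam.hasDerivAt_AdL_zero {X : E} {e : ℝ → G} (he : IsOneParam X e) (Y : E) :
    HasDerivAt (fun t => AdL E (e t) Y) (adD G X Y) 0 := by
  have h1 := (mdifferentiable_AdL (E := E) (e 0)).hasMFDerivAt.comp 0 (he.hasMFDerivAt 0)
  have h2 : HasFDerivAt (fun t => AdL E (e t)) ((tderiv E (E →L[ℝ] E) (AdL E) (e 0)).comp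
      ((1 : ℝ →L[ℝ] ℝ).smulRight (leftField X (e 0)))) 0 := hasMFDerivAt_iff_hasFDerivAt.1 h1
  have h3 := h2.hasDerivAt.clm_apply (hasDerivAt_const 0 Y)
  refine h3.congr_deriv ?_
  rw [map_zero, add_zero]
  show tderiv E (E →L[ℝ] E) (AdL E) (e 0) ((1 : ℝ) • leftField X (e 0)) Y = _
  rw [one_smul, he.zero, leftField_one]
  rfl

/-- The derivative of `Ad` is the bracket of the Lie algebra. -/
theorem adD_eq_lie (X Y : LieAlg E G) : (adD (E := E) G X Y : E) = ⁅X, Y⁆ := by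
  refine adD_eq_fieldBracket_of_self (E := E) (fun Z => ?_) X Y
  -- Differentiating `Ad (e t) Z = Z` at `0` gives `adD Z Z = 0`.
  obtain ⟨e, he⟩ := exists_isOneParam G Z
  have h1 := he.hasDerivAt_AdL_zero Z
  simp only [he.AdL_self] at h1
  exact h1.unique (hasDerivAt_const _ _)

omit [FiniteDimensional ℝ E] in
theorem IsOneParam.hasDerivAt_AdL {X : E} {e : ℝ → G} (he : IsOneParam X e) (Y : E) (t : ℝ) :
    HasDerivAt (fun t => AdL E (e t) Y) (AdL E (e t) (adD G X Y)) t := by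
  have h1 := (he.hasDerivAt_AdL_zero Y)
  rw [← sub_self t] at h1
  have h2 := h1.comp_sub_const t t
  have h3 := (AdL E (e t)).hasFDerivAt.comp_hasDerivAt t h2
  refine h3.congr_of_eventuallyEq (Filter.Eventually.of_forall fun s => ?_)
  show _ = AdL E (e t) (AdL E (e (s - t)) Y)
  rw [← AdL_mul, ← he.add, add_sub_cancel]

omit [FiniteDimensional ℝ E] in
theorem IsOneParam.AdL_eq_self {X Y : E} {e : ℝ → G} (he : IsOneParam X e) (h : adD G X Y = 0)
    (t : ℝ) : AdL E (e t) Y = Y := by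
  have h1 : ∀ t, HasDerivAt (fun t => AdL E (e t) Y) 0 t := fun t => by
    have := he.hasDerivAt_AdL Y t
    rwa [h, map_zero] at this
  have h2 := is_const_of_deriv_eq_zero (fun t => (h1 t).differentiableAt) (fun t => (h1 t).deriv) t 0
  rwa [he.zero, AdL_one] at h2

end
-- Averaging over the compact fixed-point group
section

/-- A continuous representation of a compact group preserves a positive definite form, which may be
chosen invariant under an involution that commutes with the representation. -/
theorem exists_invariant_posDef_form {E : Type*} [NormedAddCommGroup E] [NormedSpace ℝ E]
    [FiniteDimensional ℝ E] {K : Type*} [Group K] [TopologicalSpace K] [IsTopologicalGroup K]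
    [CompactSpace K] (ρ : K → E →L[ℝ] E) (hρ : Continuous ρ) (hρ1 : ∀ x, ρ 1 x = x)
    (hρmul : ∀ a b x, ρ (a * b) x = ρ a (ρ b x))
    (θ : E →ₗ[ℝ] E) (hθ : ∀ x, θ (θ x) = x) (hθρ : ∀ a x, θ (ρ a x) = ρ a (θ x)) :
    ∃ B : E →ₗ[ℝ] E →ₗ[ℝ] ℝ, (∀ x y, B x y = B y x) ∧ (∀ x, x ≠ 0 → 0 < B x x) ∧
      (∀ x y, B (θ x) (θ y) = B x y) ∧ ∀ a x y, B (ρ a x) (ρ a y) = B x y := by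
  borelize K
  let μ : Measure K := Measure.haar
  let b := Module.finBasis ℝ E
  -- The second summand makes the Euclidean form of the basis invariant under the involution `θ`.
  let B₀ : E → E → ℝ := fun x y =>
    ∑ i, (b.coord i x * b.coord i y + b.coord i (θ x) * b.coord i (θ y))
  have hcoord : ∀ i, Continuous (b.coord i) := fun i => LinearMap.continuous_of_finiteDimensional _
  have hθc : Continuous θ := LinearMap.continuous_of_finiteDimensional _
  have hcont : ∀ x y, Continuous fun a => B₀ (ρ a⁻¹ x) (ρ a⁻¹ y) := by
    intro x y
    have h : ∀ z, Continuous fun a => ρ a⁻¹ z := fun z =>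
      (hρ.comp continuous_inv).clm_apply continuous_const
    refine continuous_finsetSum _ fun i _ => ?_
    exact (((hcoord i).comp (h x)).mul ((hcoord i).comp (h y))).add
      (((hcoord i).comp (hθc.comp (h x))).mul ((hcoord i).comp (hθc.comp (h y))))
  have hint : ∀ x y, Integrable (fun a => B₀ (ρ a⁻¹ x) (ρ a⁻¹ y)) μ := fun x y =>
    (hcont x y).integrable_of_hasCompactSupport (HasCompactSupport.of_compactSpace _)
  have hB₀add : ∀ x y z, B₀ (x + y) z = B₀ x z + B₀ y z := by
    intro x y z
    simp only [B₀, map_add, ← Finset.sum_add_distrib]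
    exact Finset.sum_congr rfl fun i _ => by ring
  have hB₀smul : ∀ (c : ℝ) x z, B₀ (c • x) z = c * B₀ x z := by
    intro c x z
    simp only [B₀, map_smul, Finset.mul_sum, smul_eq_mul]
    exact Finset.sum_congr rfl fun i _ => by ring
  have hB₀symm : ∀ x y, B₀ x y = B₀ y x := by
    intro x y
    exact Finset.sum_congr rfl fun i _ => by ring
  have hB₀nonneg : ∀ x, 0 ≤ B₀ x x := fun x =>
    Finset.sum_nonneg fun i _ => add_nonneg (mul_self_nonneg _) (mul_self_nonneg _)
  have hB₀ne : ∀ x, x ≠ 0 → B₀ x x ≠ 0 := by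
    intro x hx h
    refine hx (b.ext_elem fun i => ?_)
    have h1 := (Finset.sum_eq_zero_iff_of_nonneg fun i _ =>
      add_nonneg (mul_self_nonneg _) (mul_self_nonneg _)).1 h i (Finset.mem_univ i)
    have h2 : b.coord i x * b.coord i x = 0 := by
      nlinarith [mul_self_nonneg (b.coord i x), mul_self_nonneg (b.coord i (θ x))]
    simpa using mul_self_eq_zero.1 h2
  have hB₀θ : ∀ x y, B₀ (θ x) (θ y) = B₀ x y := by
    intro x y
    simp only [B₀, hθ]
    exact Finset.sum_congr rfl fun i _ => by ring
  -- With `a⁻¹` in the integrand, applying `ρ h` to both arguments replaces `a` by `h⁻¹ a`, so left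
  -- invariance of Haar measure suffices.
  let f : E → E → ℝ := fun x y => ∫ a, B₀ (ρ a⁻¹ x) (ρ a⁻¹ y) ∂μ
  have hfsymm : ∀ x y, f x y = f y x := fun x y => by
    simp only [f]
    exact integral_congr_ae (Filter.Eventually.of_forall fun a => hB₀symm _ _)
  have hfadd : ∀ x y z, f (x + y) z = f x z + f y z := fun x y z => by
    simp only [f, map_add, hB₀add]
    exact integral_add (hint x z) (hint y z)
  have hfsmul : ∀ (c : ℝ) x z, f (c • x) z = c * f x z := fun c x z => by
    simp only [f, map_smul, hB₀smul]
    exact integral_const_mul c _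
  refine ⟨LinearMap.mk₂ ℝ f hfadd hfsmul (fun x y z => ?_) (fun c x z => ?_), hfsymm, fun x hx => ?_,
    fun x y => ?_, fun h x y => ?_⟩
  · rw [hfsymm, hfadd, hfsymm y, hfsymm z]
  · rw [hfsymm, hfsmul, hfsymm z]; rfl
  · refine (hcont x x).integral_pos_of_hasCompactSupport_nonneg_nonzero
      (HasCompactSupport.of_compactSpace _) (fun a => hB₀nonneg _) (x := 1) ?_
    rw [inv_one, hρ1]
    exact hB₀ne x hx
  · simp only [LinearMap.mk₂_apply, f, ← hθρ, hB₀θ]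
  · simp only [LinearMap.mk₂_apply, f, ← hρmul]
    have h1 := integral_mul_left_eq_self (μ := μ) (fun a => B₀ (ρ a⁻¹ x) (ρ a⁻¹ y)) h⁻¹
    simpa using h1

end

section

variable {E : Type*} [NormedAddCommGroup E] [NormedSpace ℝ E] [FiniteDimensional ℝ E]
  {G : Type*} [TopologicalSpace G] [T2Space G] [ChartedSpace E G] [Group G]
  [LieGroup 𝓘(ℝ, E) ∞ G]

omit [FiniteDimensional ℝ E] [T2Space G] [LieGroup 𝓘(ℝ, E) ∞ G] in
theorem tangentMap_involutive (σ : G →* G) (hσ : ContMDiff 𝓘(ℝ, E) 𝓘(ℝ, E) ∞ σ)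
    (hinv : ∀ g, σ (σ g) = g) (X : LieAlg E G) : tangentMap σ (tangentMap σ X) = X := by
  have hs : MDifferentiable 𝓘(ℝ, E) 𝓘(ℝ, E) σ := hσ.mdifferentiable (by simp)
  have h2 : (σ : G → G) ∘ σ = id := funext hinv
  have key : ∀ Y : E, tderiv E E σ 1 (tderiv E E σ 1 Y) = Y := fun Y => by
    have h1 := tderiv_comp (x := (1 : G)) (hs (σ 1)) (hs 1) Y
    rw [h2, tderiv_id, map_one] at h1
    exact h1.symm
  exact key X

omit [T2Space G] in
theorem tangentMap_lie (σ : G →* G) (hσ : ContMDiff 𝓘(ℝ, E) 𝓘(ℝ, E) ∞ σ)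
    (hinv : ∀ g, σ (σ g) = g) (X Y : LieAlg E G) :
    tangentMap σ ⁅X, Y⁆ = ⁅tangentMap σ X, tangentMap σ Y⁆ :=
  tderiv_lie hσ hσ hinv hinv X Y

omit [T2Space G] in
theorem Ad_lie (h : G) (X Y : LieAlg E G) : Ad h ⁅X, Y⁆ = ⁅Ad h X, Ad h Y⁆ :=
  tderiv_lie (f := (MulAut.conj h⁻¹).toMonoidHom) (f' := (MulAut.conj h).toMonoidHom)
    (contMDiff_conj h⁻¹) (contMDiff_conj h) (fun x => by simp [mul_assoc])
    (fun x => by simp [mul_assoc]) X Y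

/-- The Killing form is invariant under automorphisms of the Lie algebra. -/
theorem killingForm_map {L : Type*} [LieRing L] [LieAlgebra ℝ L] (f f' : L →ₗ[ℝ] L)
    (hf : ∀ x y, f ⁅x, y⁆ = ⁅f x, f y⁆) (h : ∀ x, f' (f x) = x) (h' : ∀ x, f (f' x) = x) (x y : L) :
    killingForm ℝ L (f x) (f y) = killingForm ℝ L x y :=
  LieAlgebra.killingForm_of_equiv_apply
    ({ f with map_lie' := fun {x y} => hf x y, invFun := f', left_inv := h, right_inv := h' } :
      L ≃ₗ⁅ℝ⁆ L) x y

omit [T2Space G] in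
theorem form_tangentMap (σ : G →* G) (hσ : ContMDiff 𝓘(ℝ, E) 𝓘(ℝ, E) ∞ σ)
    (hinv : ∀ g, σ (σ g) = g) (c : ℝ) (X Y : LieAlg E G) :
    form c (tangentMap σ X) (tangentMap σ Y) = form c X Y := by
  have h := tangentMap_involutive σ hσ hinv
  rw [form, form, killingForm_map _ _ (tangentMap_lie σ hσ hinv) h h]

omit [T2Space G] in
theorem form_Ad (g : G) (c : ℝ) (X Y : LieAlg E G) : form c (Ad g X) (Ad g Y) = form c X Y := by
  rw [form, form, killingForm_map _ (Ad g⁻¹) (Ad_lie g) (AdL_inv_AdL (E := E) g)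
    (AdL_AdL_inv (E := E) g)]

/-- The average is taken for `Ad` on `K`. If `σ_* Z = Z`, uniqueness of integral curves keeps the
one-parameter subgroup of `Z` inside `K`, and differentiating the invariance along it gives the
infinitesimal statement. -/
theorem exists_invariant_form (σ : G →* G) (hσ : ContMDiff 𝓘(ℝ, E) 𝓘(ℝ, E) ∞ σ)
    (hinv : ∀ g, σ (σ g) = g) (hK : IsCompact {g : G | σ g = g}) :
    ∃ B : LieAlg E G →ₗ[ℝ] LieAlg E G →ₗ[ℝ] ℝ, (∀ x y, B x y = B y x) ∧ (∀ x, x ≠ 0 → 0 < B x x) ∧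
      (∀ x y, B (tangentMap (E := E) σ x) (tangentMap (E := E) σ y) = B x y) ∧
      ∀ Z : LieAlg E G, tangentMap σ Z = Z → ∀ x y, B ⁅Z, x⁆ y + B x ⁅Z, y⁆ = 0 := by
  have hs : MDifferentiable 𝓘(ℝ, E) 𝓘(ℝ, E) σ := hσ.mdifferentiable (by simp)
  have : IsTopologicalGroup G := topologicalGroup_of_lieGroup 𝓘(ℝ, E) ∞
  let K : Subgroup G := MonoidHom.eqLocus σ (MonoidHom.id G)
  have hKmem : ∀ g, g ∈ K ↔ σ g = g := fun g => Iff.rfl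
  have : CompactSpace K := isCompact_iff_compactSpace.1 hK
  obtain ⟨B, hB1, hB2, hB3, hB4⟩ := exists_invariant_posDef_form (E := E) (K := K)
    (fun a => AdL E (a : G)) (contMDiff_AdL.continuous.comp continuous_subtype_val) AdL_one
    (fun a b => AdL_mul (a : G) b) (tangentMap (E := E) σ) (tangentMap_involutive σ hσ hinv)
    (fun a x => by
      have h := tderiv_AdL (E := E) σ hs a x
      rw [(hKmem _).1 a.2] at h
      exact h)
  have key : ∀ Z x y : E, tderiv E E σ 1 Z = Z → B (adD G Z x) y + B x (adD G Z y) = 0 := by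
    intro Z x y hZ
    obtain ⟨e, he⟩ := exists_isOneParam G Z
    have heK : ∀ t, e t ∈ K := fun t => by
      have h1 := he.map σ hs
      rw [hZ] at h1
      exact congrFun (h1.unique he) t
    have h1 := B.toContinuousBilinearMap.hasFDerivAt_of_bilinear
      (he.hasDerivAt_AdL_zero x).hasFDerivAt (he.hasDerivAt_AdL_zero y).hasFDerivAt
    have h2 : (fun t => B.toContinuousBilinearMap (AdL E (e t) x) (AdL E (e t) y)) =
        fun _ => B x y :=
      funext fun t => hB4 ⟨e t, heK t⟩ x y
    rw [h2] at h1
    have h3 := DFunLike.congr_fun (h1.unique (hasFDerivAt_const _ _)) 1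
    have h4 : B (AdL E (e 0) x) ((1 : ℝ) • adD G Z y) + B ((1 : ℝ) • adD G Z x) (AdL E (e 0) y) = 0 :=
      h3
    rwa [he.zero, AdL_one, AdL_one, one_smul, one_smul, add_comm] at h4
  refine ⟨B, hB1, hB2, hB3, fun Z hZ x y => ?_⟩
  have h1 := key Z x y hZ
  have e1 := adD_eq_lie Z x
  have e2 := adD_eq_lie Z y
  rw [← e1, ← e2]
  exact h1

end

/-! ### The symmetric pair: eigenspaces and the invariant form -/

section

variable {E : Type*} [NormedAddCommGroup E] [NormedSpace ℝ E] [FiniteDimensional ℝ E]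
  {G : Type*} [TopologicalSpace G] [ChartedSpace E G] [Group G] [LieGroup 𝓘(ℝ, E) ∞ G]

variable (E) in
/-- The standing assumptions on the involution `σ` and the factor `c` of the Killing form. -/
structure IsCompactPair (σ : G →* G) (c : ℝ) : Prop where
  smooth : ContMDiff 𝓘(ℝ, E) 𝓘(ℝ, E) ∞ σ
  invol : ∀ g : G, σ (σ g) = g
  compact : IsCompact {g : G | σ g = g}
  pos : ∀ X ∈ kSpace (E := E) σ, X ≠ 0 → 0 < form c X X
  ne_zero : c ≠ 0

theorem covector_apply (c : ℝ) (L X : LieAlg E G) : covector c L X = form c L X := rfl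

theorem form_comm (c : ℝ) (X Y : LieAlg E G) : form c X Y = form c Y X := by
  rw [form, form, LieModule.traceForm_comm]

theorem form_lie (c : ℝ) (X Y Z : LieAlg E G) : form c ⁅X, Y⁆ Z = form c X ⁅Y, Z⁆ := by
  rw [form, form, LieModule.traceForm_apply_lie_apply]

theorem form_add_left (c : ℝ) (X Y Z : LieAlg E G) : form c (X + Y) Z = form c X Z + form c Y Z := by
  simp only [form, map_add, LinearMap.add_apply, mul_add]

theorem form_add_right (c : ℝ) (X Y Z : LieAlg E G) :
    form c X (Y + Z) = form c X Y + form c X Z := by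
  rw [form_comm, form_add_left, form_comm c Y, form_comm c Z]

theorem form_smul_left (c a : ℝ) (X Y : LieAlg E G) : form c (a • X) Y = a * form c X Y := by
  simp only [form, map_smul, LinearMap.smul_apply, smul_eq_mul]; ring

theorem form_smul_right (c a : ℝ) (X Y : LieAlg E G) : form c X (a • Y) = a * form c X Y := by
  rw [form_comm, form_smul_left, form_comm]

theorem form_neg_left (c : ℝ) (X Y : LieAlg E G) : form c (-X) Y = - form c X Y := by
  rw [← neg_one_smul ℝ X, form_smul_left, neg_one_mul]

theorem form_neg_right (c : ℝ) (X Y : LieAlg E G) : form c X (-Y) = - form c X Y := by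
  rw [form_comm, form_neg_left, form_comm]

theorem form_sub_left (c : ℝ) (X Y Z : LieAlg E G) : form c (X - Y) Z = form c X Z - form c Y Z := by
  rw [sub_eq_add_neg, form_add_left, form_neg_left, sub_eq_add_neg]

theorem form_sub_right (c : ℝ) (X Y Z : LieAlg E G) :
    form c X (Y - Z) = form c X Y - form c X Z := by
  rw [sub_eq_add_neg, form_add_right, form_neg_right, sub_eq_add_neg]

theorem form_zero_left (c : ℝ) (X : LieAlg E G) : form c 0 X = 0 := by
  simp [form]

theorem form_zero_right (c : ℝ) (X : LieAlg E G) : form c X 0 = 0 := by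
  simp [form]

omit [FiniteDimensional ℝ E] [LieGroup 𝓘(ℝ, E) ∞ G] in
theorem mem_kSpace {σ : G →* G} {X : LieAlg E G} : X ∈ kSpace σ ↔ tangentMap σ X = X := Iff.rfl

omit [FiniteDimensional ℝ E] [LieGroup 𝓘(ℝ, E) ∞ G] in
theorem mem_pSpace {σ : G →* G} {X : LieAlg E G} : X ∈ pSpace σ ↔ tangentMap σ X = -X := Iff.rfl

omit [FiniteDimensional ℝ E] [LieGroup 𝓘(ℝ, E) ∞ G] in
theorem kPart_of_mem_kSpace {σ : G →* G} {X : LieAlg E G} (h : X ∈ kSpace σ) : kPart σ X = X := by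
  rw [kPart, mem_kSpace.1 h]; module

omit [FiniteDimensional ℝ E] [LieGroup 𝓘(ℝ, E) ∞ G] in
theorem pPart_of_mem_kSpace {σ : G →* G} {X : LieAlg E G} (h : X ∈ kSpace σ) : pPart σ X = 0 := by
  rw [pPart, mem_kSpace.1 h]; module

omit [FiniteDimensional ℝ E] [LieGroup 𝓘(ℝ, E) ∞ G] in
theorem kPart_of_mem_pSpace {σ : G →* G} {X : LieAlg E G} (h : X ∈ pSpace σ) : kPart σ X = 0 := by
  rw [kPart, mem_pSpace.1 h]; module

omit [FiniteDimensional ℝ E] [LieGroup 𝓘(ℝ, E) ∞ G] in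
theorem pPart_of_mem_pSpace {σ : G →* G} {X : LieAlg E G} (h : X ∈ pSpace σ) : pPart σ X = X := by
  rw [pPart, mem_pSpace.1 h]; module

omit [FiniteDimensional ℝ E] [LieGroup 𝓘(ℝ, E) ∞ G] in
theorem kPart_add (σ : G →* G) (X Y : LieAlg E G) : kPart σ (X + Y) = kPart σ X + kPart σ Y := by
  rw [kPart, kPart, kPart, map_add]; module

omit [FiniteDimensional ℝ E] [LieGroup 𝓘(ℝ, E) ∞ G] in
theorem pPart_add (σ : G →* G) (X Y : LieAlg E G) : pPart σ (X + Y) = pPart σ X + pPart σ Y := by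
  rw [pPart, pPart, pPart, map_add]; module

namespace IsCompactPair

variable {σ : G →* G} {c : ℝ}

theorem tangentMap_involutive (h : IsCompactPair E σ c) (X : LieAlg E G) :
    tangentMap σ (tangentMap σ X) = X :=
  AffineKilling.tangentMap_involutive σ h.smooth h.invol X

theorem kPart_mem (h : IsCompactPair E σ c) (X : LieAlg E G) : kPart σ X ∈ kSpace σ := by
  rw [mem_kSpace, kPart, map_smul, map_add, h.tangentMap_involutive, add_comm]

theorem pPart_mem (h : IsCompactPair E σ c) (X : LieAlg E G) : pPart σ X ∈ pSpace σ := by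
  rw [mem_pSpace, pPart, map_smul, map_sub, h.tangentMap_involutive, ← smul_neg, neg_sub]

theorem lie_pp (h : IsCompactPair E σ c) {X Y : LieAlg E G} (hX : X ∈ pSpace σ) (hY : Y ∈ pSpace σ) :
    ⁅X, Y⁆ ∈ kSpace σ := by
  rw [mem_kSpace, tangentMap_lie σ h.smooth h.invol, mem_pSpace.1 hX, mem_pSpace.1 hY, neg_lie,
    lie_neg, neg_neg]

theorem lie_kp (h : IsCompactPair E σ c) {X Y : LieAlg E G} (hX : X ∈ kSpace σ) (hY : Y ∈ pSpace σ) :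
    ⁅X, Y⁆ ∈ pSpace σ := by
  rw [mem_pSpace, tangentMap_lie σ h.smooth h.invol, mem_kSpace.1 hX, mem_pSpace.1 hY, lie_neg]

theorem lie_pk (h : IsCompactPair E σ c) {X Y : LieAlg E G} (hX : X ∈ pSpace σ) (hY : Y ∈ kSpace σ) :
    ⁅X, Y⁆ ∈ pSpace σ := by
  rw [mem_pSpace, tangentMap_lie σ h.smooth h.invol, mem_pSpace.1 hX, mem_kSpace.1 hY, neg_lie]

theorem lie_kk (h : IsCompactPair E σ c) {X Y : LieAlg E G} (hX : X ∈ kSpace σ) (hY : Y ∈ kSpace σ) :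
    ⁅X, Y⁆ ∈ kSpace σ := by
  rw [mem_kSpace, tangentMap_lie σ h.smooth h.invol, mem_kSpace.1 hX, mem_kSpace.1 hY]

theorem form_kp (h : IsCompactPair E σ c) {X Y : LieAlg E G} (hX : X ∈ kSpace σ) (hY : Y ∈ pSpace σ) :
    form c X Y = 0 := by
  have h1 := form_tangentMap σ h.smooth h.invol c X Y
  rw [mem_kSpace.1 hX, mem_pSpace.1 hY, form_neg_right] at h1
  linarith

theorem form_pk (h : IsCompactPair E σ c) {X Y : LieAlg E G} (hX : X ∈ pSpace σ) (hY : Y ∈ kSpace σ) :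
    form c X Y = 0 := by
  rw [form_comm, h.form_kp hY hX]

theorem eq_zero_of_form_self (h : IsCompactPair E σ c) {X : LieAlg E G} (hX : X ∈ kSpace σ)
    (h0 : form c X X = 0) : X = 0 := by
  by_contra hne
  exact (h.pos X hX hne).ne' h0

/-- On elements of `𝔭` the deformed brackets induce the same coadjoint action. -/
theorem form_deformedBracket (h : IsCompactPair E σ c) (s : ℝ) {L A U : LieAlg E G}
    (hL : L ∈ pSpace σ) (hA : A ∈ pSpace σ) (hU : U ∈ kSpace σ) (X : LieAlg E G) :
    form c L (deformedBracket σ s (A + U) X) = form c ⁅L, A + U⁆ X := by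
  -- The term with `s` lies in `𝔨`, orthogonal to `L`. The value is therefore independent of `s` and
  -- can be computed at `s = 1`, for the bracket of `𝔤`.
  have key : ∀ s : ℝ, form c L (deformedBracket σ s (A + U) X) =
      form c L ⁅U, pPart σ X⁆ - form c L ⁅kPart σ X, A⁆ := by
    intro s
    rw [deformedBracket, kPart_add, pPart_add, kPart_of_mem_pSpace hA, kPart_of_mem_kSpace hU,
      pPart_of_mem_pSpace hA, pPart_of_mem_kSpace hU, zero_add, add_zero, form_add_right,
      form_add_right, form_sub_right, form_smul_right, h.form_pk hL (h.lie_kk hU (h.kPart_mem X)),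
      h.form_pk hL (h.lie_pp hA (h.pPart_mem X)), mul_zero, add_zero, add_zero]
  rw [key, ← key 1, deformedBracket_one, form_lie]

variable [LieAlgebra.IsSemisimple ℝ (LieAlg E G)]

theorem eq_zero_of_form (h : IsCompactPair E σ c) {X : LieAlg E G} (h0 : ∀ Y, form c X Y = 0) :
    X = 0 := by
  have hfin : FiniteDimensional ℝ (LieAlg E G) := inferInstanceAs (FiniteDimensional ℝ E)
  have h1 := LieAlgebra.IsKilling.ker_killingForm_eq_bot ℝ (LieAlg E G)
  refine (Submodule.mem_bot ℝ).1 (h1 ▸ LinearMap.mem_ker.2 (LinearMap.ext fun Y => ?_))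
  exact (mul_eq_zero.1 (h0 Y)).resolve_left h.ne_zero

theorem exists_covector_eq (h : IsCompactPair E σ c) (l : Module.Dual ℝ (LieAlg E G)) :
    ∃ L : LieAlg E G, l = covector c L := by
  have hfin : FiniteDimensional ℝ (LieAlg E G) := inferInstanceAs (FiniteDimensional ℝ E)
  let f : LieAlg E G →ₗ[ℝ] Module.Dual ℝ (LieAlg E G) := c • killingForm ℝ (LieAlg E G)
  have hinj : Function.Injective f := (injective_iff_map_eq_zero f).2 fun X hX =>
    h.eq_zero_of_form fun Y => LinearMap.congr_fun hX Y
  have hsurj := (LinearMap.injective_iff_surjective_of_finrank_eq_finrank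
    (Subspace.dual_finrank_eq (K := ℝ) (V := LieAlg E G)).symm).1 hinj
  obtain ⟨L, hL⟩ := hsurj l
  exact ⟨L, hL.symm⟩

-- The `𝔨`-part of `L` is orthogonal to itself, and the form is definite on `𝔨`.
omit [LieAlgebra.IsSemisimple ℝ (LieAlg E G)] in
theorem mem_pSpace_of_form (h : IsCompactPair E σ c) {L : LieAlg E G}
    (h0 : ∀ X ∈ kSpace (E := E) σ, form c L X = 0) : L ∈ pSpace σ := by
  have h1 : kPart σ L = 0 := by
    refine h.eq_zero_of_form_self (h.kPart_mem L) ?_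
    have h2 := h0 _ (h.kPart_mem L)
    rwa [← kPart_add_pPart σ L, form_add_left, kPart_add_pPart,
      h.form_pk (h.pPart_mem L) (h.kPart_mem L), add_zero] at h2
  have h3 := kPart_add_pPart σ L
  rw [h1, zero_add] at h3
  exact h3 ▸ h.pPart_mem L

/-- The form is nondegenerate on the centralizer in `𝔭` of an element of `𝔭`. -/
theorem eq_zero_of_centralizer [T2Space G] (h : IsCompactPair E σ c) {A X : LieAlg E G}
    (hA : A ∈ pSpace σ) (hX : X ∈ pSpace σ) (hAX : ⁅A, X⁆ = 0)
    (horth : ∀ Y ∈ pSpace (E := E) σ, ⁅A, Y⁆ = 0 → form c X Y = 0) : X = 0 := by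
  have hfin : FiniteDimensional ℝ (LieAlg E G) := inferInstanceAs (FiniteDimensional ℝ E)
  obtain ⟨B, hB1, hB2, hB3, hB4⟩ := exists_invariant_form (E := E) σ h.smooth h.invol h.compact
  exact eq_zero_of_commutes_of_orthogonal_of_posDef (c • killingForm ℝ (LieAlg E G)) (form_lie c)
    (form_comm c) (fun x hx => h.eq_zero_of_form hx) (tangentMap σ) h.tangentMap_involutive
    (tangentMap_lie σ h.smooth h.invol) (form_tangentMap σ h.smooth h.invol c) h.pos B hB1 hB2 hB3
    hB4 hA hX hAX horth

end IsCompactPair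

/-- The hypotheses of the theorem force the scalar factor of the Killing form to be nonzero. -/
theorem isCompactPair_of_ne [ConnectedSpace G] [LieAlgebra.IsSemisimple ℝ (LieAlg E G)]
    (σ : G →* G) (hσ : ContMDiff 𝓘(ℝ, E) 𝓘(ℝ, E) ∞ σ)
    (hinv : ∀ g : G, σ (σ g) = g) (hne : ∃ g : G, σ g ≠ g) (hK : IsCompact {g : G | σ g = g})
    (c : ℝ) (hc : ∀ X ∈ kSpace (E := E) σ, X ≠ 0 → 0 < form c X X) : IsCompactPair E σ c := by
  refine ⟨hσ, hinv, hK, hc, fun hc0 => ?_⟩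
  -- If `c = 0`, positivity on `𝔨` forces `𝔨 = 0`, so `σ_* = -1`. Brackets are fixed by `σ_*` and
  -- hence vanish; an abelian semisimple algebra is zero, so the connected group `G` is discrete,
  -- thus trivial, against `σ ≠ id`.
  have hk : ∀ X ∈ kSpace (E := E) σ, X = 0 := fun X hX => by
    by_contra h
    have := hc X hX h
    rw [form, hc0, zero_mul] at this
    exact lt_irrefl _ this
  have hp : ∀ X : LieAlg E G, tangentMap σ X = -X := fun X => by
    have h1 := hk (X + tangentMap σ X) (by
      rw [mem_kSpace, map_add, AffineKilling.tangentMap_involutive σ hσ hinv, add_comm])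
    exact eq_neg_of_add_eq_zero_right h1
  have hab : ∀ X Y : LieAlg E G, ⁅X, Y⁆ = 0 := fun X Y => hk _ (by
    rw [mem_kSpace, tangentMap_lie σ hσ hinv, hp, hp, neg_lie, lie_neg, neg_neg])
  have : IsLieAbelian (LieAlg E G) := ⟨hab⟩
  have hsub : Subsingleton (LieAlg E G) :=
    LieAlgebra.subsingleton_of_hasTrivialRadical_lie_abelian ℝ (LieAlg E G)
  have hE : Subsingleton E := hsub
  have hdisc : DiscreteTopology G := by
    refine discreteTopology_iff_isOpen_singleton.2 fun x => ?_
    have h1 : (chartAt E x).source = {x} := by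
      refine eq_singleton_iff_unique_mem.2 ⟨mem_chart_source E x, fun y hy => ?_⟩
      exact (chartAt E x).injOn hy (mem_chart_source E x) (Subsingleton.elim _ _)
    exact h1 ▸ (chartAt E x).open_source
  obtain ⟨g, hg⟩ := hne
  have := PreconnectedSpace.trivial_of_discrete (X := G)
  exact hg (Subsingleton.elim _ _)

end

/-! ### Absolutely continuous functions with almost everywhere conditions -/

section

theorem ae_restrict_Icc_mem_Ioo (T : ℝ) : ∀ᵐ t ∂volume.restrict (Icc 0 T), t ∈ Ioo 0 T := by
  rw [← restrict_Ioo_eq_restrict_Icc]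
  exact ae_restrict_mem measurableSet_Ioo

theorem hasDerivAt_zero_of_eqOn_Icc {f : ℝ → ℝ} {T a t : ℝ} (h : ∀ t ∈ Icc 0 T, f t = a)
    (ht : t ∈ Ioo 0 T) : HasDerivAt f 0 t :=
  (hasDerivAt_const t a).congr_of_eventuallyEq (by
    filter_upwards [Ioo_mem_nhds ht.1 ht.2] with s hs using h s (Ioo_subset_Icc_self hs))

theorem absolutelyContinuousOnInterval_of_eqOn {f : ℝ → ℝ} {T a : ℝ} (hT : 0 ≤ T)
    (h : ∀ t ∈ Icc 0 T, f t = a) : AbsolutelyContinuousOnInterval f 0 T := by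
  refine LipschitzOnWith.absolutelyContinuousOnInterval (K := 0) fun x hx y hy => ?_
  rw [uIcc_of_le hT] at hx hy
  rw [h x hx, h y hy, edist_self]
  exact bot_le

theorem AbsolutelyContinuousOnInterval.continuousOn_Icc {f : ℝ → ℝ} {T : ℝ} (hT : 0 ≤ T)
    (h : AbsolutelyContinuousOnInterval f 0 T) : ContinuousOn f (Icc 0 T) := by
  have := h.continuousOn
  rwa [uIcc_of_le hT] at this

theorem eqOn_zero_of_ae {f : ℝ → ℝ} {T : ℝ} (hT : 0 < T) (hf : ContinuousOn f (Icc 0 T))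
    (h : ∀ᵐ t ∂volume.restrict (Icc 0 T), f t = 0) : ∀ t ∈ Icc 0 T, f t = 0 :=
  Measure.eqOn_Icc_of_ae_eq volume hT.ne h hf continuousOn_const

theorem exists_const_of_ae_hasDerivAt_zero {f : ℝ → ℝ} {T : ℝ} (hT : 0 ≤ T)
    (hf : AbsolutelyContinuousOnInterval f 0 T)
    (h : ∀ᵐ t ∂volume.restrict (Icc 0 T), HasDerivAt f 0 t) : ∀ t ∈ Icc 0 T, f t = f 0 := by
  obtain ⟨C, hC⟩ := hf.const_of_ae_hasDerivAt_zero (by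
    rw [uIcc_of_le hT]
    exact (ae_restrict_iff' measurableSet_Icc).1 h)
  rw [uIcc_of_le hT] at hC
  exact fun t ht => (hC t ht).trans (hC 0 (left_mem_Icc.2 hT)).symm

end

/-! ### Characterization of the abnormal extremals -/

section

variable {E : Type*} [NormedAddCommGroup E] [NormedSpace ℝ E] [FiniteDimensional ℝ E]
  {G : Type*} [TopologicalSpace G] [T2Space G] [ChartedSpace E G] [Group G]
  [LieGroup 𝓘(ℝ, E) ∞ G] [LieAlgebra.IsSemisimple ℝ (LieAlg E G)]
  {σ : G →* G} {c ε s T : ℝ} {A : LieAlg E G}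
  {l : ℝ → Module.Dual ℝ (LieAlg E G)} {U : ℝ → LieAlg E G}

omit [T2Space G] in
theorem AbnormalConstraints.isExtremalLift (h : IsCompactPair E σ c) (hA : A ∈ pSpace σ)
    (hT : 0 < T) (hU : IsControl σ c T U) {L : LieAlg E G} (hL0 : L ≠ 0)
    (hL : AbnormalConstraints σ c T A L l U) : IsExtremalLift σ c ε s T A 0 l U where
  absolutelyContinuous X := absolutelyContinuousOnInterval_of_eqOn hT.le
    (a := covector c L X) fun t ht => by rw [hL.lift_eq t ht]
  derivative X := by
    filter_upwards [ae_restrict_Icc_mem_Ioo T, hL.lie_U] with t ht htU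
    have ht' := Ioo_subset_Icc_self ht
    have h1 : l t (deformedBracket σ s (A + U t) X) = 0 := by
      rw [hL.lift_eq t ht', covector_apply, h.form_deformedBracket s hL.mem hA (hU.mem t ht'),
        lie_add, htU, add_zero, ← lie_skew, hL.lie_A, neg_zero, form_zero_left]
    rw [h1, mul_zero]
    exact hasDerivAt_zero_of_eqOn_Icc (a := covector c L X)
      (fun t ht => by rw [hL.lift_eq t ht]) ht
  nonpos := le_rfl
  nontrivial _ t ht h0 := hL0 <| h.eq_zero_of_form fun Y => by
    rw [← covector_apply, ← hL.lift_eq t ht, h0, LinearMap.zero_apply]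
  maximal := by
    filter_upwards [ae_restrict_mem measurableSet_Icc] with t ht V hV
    rw [hamiltonian, hamiltonian, hL.lift_eq t ht, map_add, map_add, covector_apply,
      covector_apply, covector_apply, h.form_pk hL.mem hV, h.form_pk hL.mem (hU.mem t ht)]
    simp

theorem IsExtremalLift.exists_abnormalConstraints (h : IsCompactPair E σ c) (hA : IsRegular σ A)
    (hT : 0 < T) (hε : ε ≠ 0) (hU : IsControl σ c T U) (hl : IsExtremalLift σ c ε s T A 0 l U) :
    ∃ L : LieAlg E G, L ≠ 0 ∧ AbnormalConstraints σ c T A L l U := by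
  have hcont : ∀ X, ContinuousOn (fun t => l t X) (Icc 0 T) := fun X =>
    AbsolutelyContinuousOnInterval.continuousOn_Icc hT.le (hl.absolutelyContinuous X)
  have hlk : ∀ V ∈ kSpace (E := E) σ, ∀ t ∈ Icc 0 T, l t V = 0 := by
    intro V hV
    refine eqOn_zero_of_ae hT (hcont V) ?_
    filter_upwards [hl.maximal] with t ht
    -- Maximality on the whole line through `V` bounds a linear function of `a` from above, so its
    -- slope is zero. Continuity of `l` then extends this from almost all `t` to all `t`.
    have h1 : ∀ a : ℝ, a * l t V ≤ l t (U t) := fun a => by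
      have h2 := ht (a • V) ((kSpace σ).smul_mem a hV)
      simp only [hamiltonian, zero_mul, zero_add, map_add, map_smul, smul_eq_mul] at h2
      linarith
    by_contra hne
    have h2 := h1 ((l t (U t) + 1) / l t V)
    rw [div_mul_cancel₀ _ hne] at h2
    linarith
  choose L hL using fun t => h.exists_covector_eq (l t)
  have hLX : ∀ t X, l t X = form c (L t) X := fun t X => by rw [hL t, covector_apply]
  have hLp : ∀ t ∈ Icc 0 T, L t ∈ pSpace σ := fun t ht =>
    h.mem_pSpace_of_form fun X hX => by rw [← hLX, hlk X hX t ht]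
  have hder : ∀ X, ∀ᵐ t ∂volume.restrict (Icc 0 T),
      HasDerivAt (fun τ => l τ X) (ε * form c ⁅L t, A + U t⁆ X) t := by
    intro X
    filter_upwards [hl.derivative X, ae_restrict_mem measurableSet_Icc] with t ht htI
    rwa [hLX, h.form_deformedBracket s (hLp t htI) hA.1 (hU.mem t htI)] at ht
  have hLA : ∀ t ∈ Icc 0 T, ⁅A, L t⁆ = 0 := by
    -- Since `l` vanishes on `𝔨`, so does its derivative there; `[L, U] ∈ 𝔭` does not contribute,
    -- which leaves `⟨[L, A], X⟩ = 0`.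
    have h1 : ∀ X ∈ kSpace (E := E) σ, ∀ t ∈ Icc 0 T, l t ⁅A, X⁆ = 0 := by
      intro X hX
      refine eqOn_zero_of_ae hT (hcont _) ?_
      filter_upwards [hder X, ae_restrict_Icc_mem_Ioo T] with t ht htI
      have htI' := Ioo_subset_Icc_self htI
      have h2 := ht.unique (hasDerivAt_zero_of_eqOn_Icc (hlk X hX) htI)
      rw [lie_add, form_add_left, h.form_pk (h.lie_pk (hLp t htI') (hU.mem t htI')) hX, add_zero,
        form_lie, ← hLX] at h2
      exact (mul_eq_zero.1 h2).resolve_left hε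
    intro t ht
    have h2 := h.lie_pp hA.1 (hLp t ht)
    refine h.eq_zero_of_form_self h2 ?_
    rw [← lie_skew, form_neg_left, form_lie, lie_skew, ← hLX, h1 _ h2 t ht, neg_zero]
  have h0 : (0 : ℝ) ∈ Icc 0 T := left_mem_Icc.2 hT.le
  -- `L t - L 0` centralizes `A`, so only its pairings with `Y` in that centralizer matter. Their
  -- derivative is a multiple of `⟨A + U, [L, Y]⟩`, which vanishes because regularity of `A` gives
  -- `[L, Y] = 0`.
  have hconst : ∀ t ∈ Icc 0 T, L t = L 0 := by
    intro t ht
    refine sub_eq_zero.1 (h.eq_zero_of_centralizer hA.1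
      ((pSpace σ).sub_mem (hLp t ht) (hLp 0 h0)) ?_ fun Y hY hAY => ?_)
    · rw [lie_sub, hLA t ht, hLA 0 h0, sub_zero]
    · rw [form_sub_left, ← hLX, ← hLX, sub_eq_zero]
      refine exists_const_of_ae_hasDerivAt_zero hT.le (hl.absolutelyContinuous Y) ?_ t ht
      filter_upwards [hder Y, ae_restrict_mem measurableSet_Icc] with τ hτ hτI
      have h3 : form c ⁅L τ, A + U τ⁆ Y = 0 := by
        rw [← lie_skew, form_neg_left, form_lie,
          hA.2 _ (hLp τ hτI) _ hY (hLA τ hτI) hAY, form_zero_right, neg_zero]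
      rwa [h3, mul_zero] at hτ
  refine ⟨L 0, fun hL0 => ?_, hLp 0 h0, fun t ht => by rw [← hconst t ht, ← hL], hLA 0 h0, ?_⟩
  · refine hl.nontrivial rfl 0 h0 (LinearMap.ext fun X => ?_)
    rw [hLX, hL0, form_zero_left, LinearMap.zero_apply]
  · let b : Module.Basis (Fin (Module.finrank ℝ E)) ℝ (LieAlg E G) := Module.finBasis ℝ E
    -- The exceptional null set in the equation for `l` depends on the test vector; a finite basis
    -- leaves a single null set.
    have h1 : ∀ᵐ t ∂volume.restrict (Icc 0 T), ∀ i, form c ⁅L 0, U t⁆ (b i) = 0 := by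
      rw [ae_all_iff]
      intro i
      filter_upwards [hder (b i), ae_restrict_Icc_mem_Ioo T] with t ht htI
      have htI' := Ioo_subset_Icc_self htI
      have h2 := ht.unique (hasDerivAt_zero_of_eqOn_Icc (T := T) (a := l 0 (b i))
        (fun τ hτ => by rw [hLX, hLX, hconst τ hτ]) htI)
      have h3 := (mul_eq_zero.1 h2).resolve_left hε
      rwa [hconst t htI', lie_add, ← lie_skew, hLA 0 h0, neg_zero, zero_add] at h3
    filter_upwards [h1] with t ht
    refine h.eq_zero_of_form fun Y => ?_
    have h2 : covector c ⁅L 0, U t⁆ = 0 := b.ext fun i => ht i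
    rw [← covector_apply, h2, LinearMap.zero_apply]

end

/-! ### Regularity of the varied curves -/

section

theorem abs_sub_le_of_ae_hasDerivAt {f : ℝ → ℝ} {T M : ℝ} (hT : 0 ≤ T)
    (hf : AbsolutelyContinuousOnInterval f 0 T)
    (h : ∀ᵐ t ∂volume.restrict (Icc 0 T), ∃ d, HasDerivAt f d t ∧ |d| ≤ M) :
    ∀ x ∈ Icc 0 T, ∀ y ∈ Icc 0 T, |f x - f y| ≤ M * |x - y| := by
  intro x hx y hy
  have hsub : uIcc y x ⊆ uIcc 0 T := by
    rw [uIcc_of_le hT]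
    exact uIcc_subset_Icc hy hx
  rw [← (hf.mono hsub).integral_deriv_eq_sub, ← Real.norm_eq_abs]
  refine intervalIntegral.norm_integral_le_of_norm_le_const_ae ?_
  filter_upwards [(ae_restrict_iff' measurableSet_Icc).1 h] with t ht htm
  obtain ⟨d, hd, hdM⟩ := ht (uIcc_of_le hT ▸ hsub (uIoc_subset_uIcc htm))
  rw [hd.deriv]
  exact hdM

end

section

variable {E : Type*} [NormedAddCommGroup E] [NormedSpace ℝ E]
  {G : Type*} [TopologicalSpace G] [ChartedSpace E G] [Group G]

/-- The differential of `f` at `y`, in the left trivialization of the tangent bundle. -/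
noncomputable def leftDiff (E : Type*) [NormedAddCommGroup E] [NormedSpace ℝ E]
    {G : Type*} [TopologicalSpace G] [ChartedSpace E G] [Group G] (f : G → ℝ) (y : G) : E →L[ℝ] ℝ :=
  tderiv E ℝ (fun x => f (y * x)) (1 : G)

variable [LieGroup 𝓘(ℝ, E) ∞ G]

theorem leftDiff_apply {f : G → ℝ} (hf : MDifferentiable 𝓘(ℝ, E) 𝓘(ℝ, ℝ) f) (y : G) (X : E) :
    leftDiff E f y X = tderiv E ℝ f y (leftField X y) := by
  have h1 := tderiv_comp (x := (1 : G)) (hf (y * 1)) (mdifferentiable_mul_left (E := E) y 1) X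
  rw [mul_one] at h1
  exact h1

/-- The left trivialization puts all differentials into one dual space, so continuity bounds their
norms on compact subsets of `G`. -/
theorem continuous_leftDiff {f : G → ℝ} (hf : ContMDiff 𝓘(ℝ, E) 𝓘(ℝ, ℝ) ∞ f) :
    Continuous (leftDiff E f) := by
  have : IsManifold 𝓘(ℝ, E) 1 G := IsManifold.of_le (n := ∞) (by simp)
  rw [continuous_iff_continuousAt]
  intro x₀
  have h1 : ContMDiffAt (𝓘(ℝ, E).prod 𝓘(ℝ, E)) 𝓘(ℝ, ℝ) ∞
      (Function.uncurry fun (y : G) (x : G) => f (y * x)) (x₀, (1 : G)) :=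
    hf.contMDiffAt.comp _ (contMDiff_mul 𝓘(ℝ, E) ∞).contMDiffAt
  have h2 := ContMDiffAt.mfderiv (m := ∞) (x₀ := x₀) (fun (y : G) (x : G) => f (y * x))
    (fun _ => (1 : G)) h1 contMDiffAt_const (by simp)
  have h3 : inTangentCoordinates 𝓘(ℝ, E) 𝓘(ℝ, ℝ) (fun _ : G => (1 : G)) (fun y => f (y * 1))
      (leftDiff E f) x₀ = leftDiff E f := by
    ext y v
    rw [inTangentCoordinates_eq (x₀ := x₀) (x := y) (fun _ : G => (1 : G)) (fun y => f (y * 1))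
      (leftDiff E f) (mem_chart_source E (1 : G)) (by simp [chartAt_self_eq])]
    have hc : ∀ w : E, (tangentBundleCore 𝓘(ℝ, E) G).coordChange (achart E (1 : G))
        (achart E (1 : G)) 1 w = w :=
      fun w => tangentCoordChange_self (mem_extChartAt_source 1)
    rw [ContinuousLinearMap.comp_apply, ContinuousLinearMap.comp_apply, hc,
      tangentBundleCore_coordChange_model_space]
    rfl
  exact (h3 ▸ h2.continuousAt :)

theorem hasDerivAt_comp_of_hasMFDerivAt {f : G → ℝ} (hf : MDifferentiable 𝓘(ℝ, E) 𝓘(ℝ, ℝ) f)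
    {γ : ℝ → G} {t : ℝ} {X : E} (hγ : HasMFDerivAt 𝓘(ℝ, ℝ) 𝓘(ℝ, E) γ t
      ((1 : ℝ →L[ℝ] ℝ).smulRight (leftField X (γ t) : E) : ℝ →L[ℝ] E)) :
    HasDerivAt (fun t => f (γ t)) (leftDiff E f (γ t) X) t := by
  have h1 : HasFDerivAt (fun t => f (γ t)) ((tderiv E ℝ f (γ t)).comp
      ((1 : ℝ →L[ℝ] ℝ).smulRight (leftField X (γ t)))) t :=
    hasMFDerivAt_iff_hasFDerivAt.1 ((hf (γ t)).hasMFDerivAt.comp t hγ)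
  refine h1.hasDerivAt.congr_deriv ?_
  rw [leftDiff_apply hf]
  show tderiv E ℝ f (γ t) ((1 : ℝ) • leftField X (γ t)) = _
  rw [one_smul]

/-- A product `g(t) e(φ(t))` with a one-parameter subgroup `e` of `X` satisfies
`dg/dt = g (Ad(e)⁻¹ Y + φ' X)` if `dg/dt = g Y`. -/
theorem hasMFDerivAt_mul_oneParam {g : ℝ → G} {t : ℝ} {Y X : E} {e : ℝ → G} (he : IsOneParam X e)
    (hg : HasMFDerivAt 𝓘(ℝ, ℝ) 𝓘(ℝ, E) g t
      ((1 : ℝ →L[ℝ] ℝ).smulRight (leftField Y (g t) : E) : ℝ →L[ℝ] E))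
    {φ : ℝ → ℝ} {v : ℝ} (hφ : HasDerivAt φ v t) :
    HasMFDerivAt 𝓘(ℝ, ℝ) 𝓘(ℝ, E) (fun t => g t * e (φ t)) t
      ((1 : ℝ →L[ℝ] ℝ).smulRight
        (leftField (AdL E (e (φ t))⁻¹ Y + v • X) (g t * e (φ t)) : E) : ℝ →L[ℝ] E) := by
  have h1 : HasMFDerivAt 𝓘(ℝ, ℝ) 𝓘(ℝ, E) (fun t => e (φ t)) t
      (((1 : ℝ →L[ℝ] ℝ).smulRight (leftField X (e (φ t)) : E)).comp
        ((1 : ℝ →L[ℝ] ℝ).smulRight v)) :=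
    (he.hasMFDerivAt (φ t)).comp t hφ.hasFDerivAt.hasMFDerivAt
  refine (HasMFDerivAt.group_mul hg h1).congr_mfderiv ?_
  ext
  show tderiv E E (· * e (φ t)) (g t) ((1 : ℝ) • leftField Y (g t)) +
    tderiv E E (g t * ·) (e (φ t)) (((1 : ℝ) • v) • leftField X (e (φ t))) =
    (1 : ℝ) • leftField (AdL E (e (φ t))⁻¹ Y + v • X) (g t * e (φ t))
  rw [one_smul, one_smul, one_smul, map_smul, tderiv_mul_right_leftField,
    tderiv_mul_left_leftField]
  simp only [leftField, map_add, map_smul]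

end

section

/-- A form which is positive definite on a subspace bounds the square of the norm there. -/
theorem exists_norm_sq_le_of_pos {E : Type*} [NormedAddCommGroup E] [NormedSpace ℝ E]
    [FiniteDimensional ℝ E] (B : E →ₗ[ℝ] E →ₗ[ℝ] ℝ) (k : Submodule ℝ E)
    (hpos : ∀ X ∈ k, X ≠ 0 → 0 < B X X) : ∃ m > 0, ∀ X ∈ k, m * ‖X‖ ^ 2 ≤ B X X := by
  have hS : IsCompact (Metric.sphere (0 : E) 1 ∩ k) :=
    (isCompact_sphere (0 : E) 1).inter_right k.closed_of_finiteDimensional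
  have hcont : Continuous fun X : E => B X X := by
    have h : Continuous fun X : E => B.toContinuousBilinearMap X X := by fun_prop
    exact h
  obtain ⟨m, hm, hmS⟩ : ∃ m > 0, ∀ X ∈ Metric.sphere (0 : E) 1 ∩ k, m ≤ B X X := by
    rcases (Metric.sphere (0 : E) 1 ∩ k : Set E).eq_empty_or_nonempty with he | hne
    · exact ⟨1, one_pos, fun X hX => absurd hX (he ▸ notMem_empty X)⟩
    · obtain ⟨X₀, hX₀, hmin⟩ := hS.exists_isMinOn hne hcont.continuousOn
      refine ⟨_, hpos X₀ hX₀.2 fun h0 => ?_, fun X hX => hmin hX⟩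
      have h1 : ‖X₀‖ = 1 := by simpa using hX₀.1
      rw [h0, norm_zero] at h1
      exact zero_ne_one h1
  refine ⟨m, hm, fun X hX => ?_⟩
  rcases eq_or_ne X 0 with rfl | hne
  · simp
  · have hn : ‖X‖ ≠ 0 := norm_ne_zero_iff.2 hne
    have h1 := hmS (‖X‖⁻¹ • X) ⟨by simp [norm_smul, hn], k.smul_mem _ hX⟩
    rw [map_smul, map_smul, LinearMap.smul_apply, smul_eq_mul, smul_eq_mul] at h1
    have h3 := mul_le_mul_of_nonneg_right h1 (sq_nonneg ‖X‖)
    have h4 : ‖X‖⁻¹ * (‖X‖⁻¹ * B X X) * ‖X‖ ^ 2 = B X X := by field_simp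
    rwa [h4] at h3

end

section

variable {E : Type*} [NormedAddCommGroup E] [NormedSpace ℝ E] [FiniteDimensional ℝ E]
  {G : Type*} [TopologicalSpace G] [ChartedSpace E G] [Group G] [LieGroup 𝓘(ℝ, E) ∞ G]
  {σ : G →* G} {c T : ℝ} {A X : LieAlg E G} {U : ℝ → LieAlg E G}

theorem IsCompactPair.exists_norm_sq_le (h : IsCompactPair E σ c) :
    ∃ m > 0, ∀ X ∈ kSpace (E := E) σ, m * @norm E _ X ^ 2 ≤ form c X X := by
  let B : E →ₗ[ℝ] E →ₗ[ℝ] ℝ := c • killingForm ℝ (LieAlg E G)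
  exact exists_norm_sq_le_of_pos B (kSpace (E := E) σ) h.pos

/-- Boundedness of a control is expressed by the form; definiteness on `𝔨` turns it into the norm
bound used in the Lipschitz estimates. -/
theorem IsControl.exists_norm_le (h : IsCompactPair E σ c) (hU : IsControl σ c T U) :
    ∃ M, ∀ t ∈ Icc 0 T, @norm E _ (U t) ≤ M := by
  obtain ⟨m, hm, hmk⟩ := h.exists_norm_sq_le
  obtain ⟨C, hC⟩ := hU.bounded
  refine ⟨Real.sqrt (C / m), fun t ht => Real.le_sqrt_of_sq_le ?_⟩
  rw [le_div_iff₀ hm, mul_comm]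
  exact (hmk _ (hU.mem t ht)).trans (hC t ht)

open scoped Pointwise in
omit [FiniteDimensional ℝ E] in
/-- The product of a curve with bounded velocity and a Lipschitz curve in a one-parameter subgroup
is absolutely continuous. -/
theorem absolutelyContinuousOnInterval_mul_oneParam {g : ℝ → G} {W : ℝ → E} {M : ℝ} (hT : 0 ≤ T)
    (hgc : ContinuousOn g (Icc 0 T))
    (hg : ∀ f : G → ℝ, ContMDiff 𝓘(ℝ, E) 𝓘(ℝ, ℝ) ∞ f →
      AbsolutelyContinuousOnInterval (fun t => f (g t)) 0 T)
    (hder : ∀ᵐ t ∂volume.restrict (Icc 0 T), HasMFDerivAt 𝓘(ℝ, ℝ) 𝓘(ℝ, E) g t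
      ((1 : ℝ →L[ℝ] ℝ).smulRight (leftField (W t) (g t) : E) : ℝ →L[ℝ] E))
    (hW : ∀ t ∈ Icc 0 T, ‖W t‖ ≤ M)
    {X : E} {e : ℝ → G} (he : IsOneParam X e) {φ : ℝ → ℝ} {K : NNReal} (hφ : LipschitzWith K φ)
    {f : G → ℝ} (hf : ContMDiff 𝓘(ℝ, E) 𝓘(ℝ, ℝ) ∞ f) :
    AbsolutelyContinuousOnInterval (fun t => f (g t * e (φ t))) 0 T := by
  have hgrp : IsTopologicalGroup G := topologicalGroup_of_lieGroup 𝓘(ℝ, E) ∞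
  have hf1 : MDifferentiable 𝓘(ℝ, E) 𝓘(ℝ, ℝ) f := hf.mdifferentiable (by simp)
  have hec : Continuous e := he.curve.continuous
  obtain ⟨S, hS⟩ := isCompact_Icc.exists_bound_of_continuousOn (s := Icc 0 T)
    hφ.continuous.continuousOn
  have hφS : ∀ t ∈ Icc 0 T, φ t ∈ Icc (-S) S := fun t ht => abs_le.1 (hS t ht)
  have hM : 0 ≤ M := (norm_nonneg _).trans (hW 0 (left_mem_Icc.2 hT))
  have hcomp : IsCompact (g '' Icc 0 T * e '' Icc (-S) S) :=
    (isCompact_Icc.image_of_continuousOn hgc).mul (isCompact_Icc.image hec)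
  obtain ⟨Q, hQ⟩ := hcomp.exists_bound_of_continuousOn (continuous_leftDiff hf).continuousOn
  obtain ⟨R, hR⟩ := (isCompact_Icc (a := -S) (b := S)).exists_bound_of_continuousOn
    ((contMDiff_AdL (E := E)).continuous.comp hec.inv).continuousOn
  have hQ' : ∀ t ∈ Icc 0 T, ∀ s ∈ Icc (-S) S, ‖leftDiff E f (g t * e s)‖ ≤ Q := fun t ht s hs =>
    hQ _ (Set.mul_mem_mul (mem_image_of_mem g ht) (mem_image_of_mem e hs))
  have h0 := left_mem_Icc.2 hT
  have hQ0 : 0 ≤ Q := (norm_nonneg _).trans (hQ' 0 h0 _ (hφS 0 h0))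
  have hR0 : 0 ≤ R := (norm_nonneg _).trans (hR _ (hφS 0 h0))
  -- `f (g t * e s)` is Lipschitz in `s` and in `t` separately, with uniform constants; the triangle
  -- inequality then makes the composite with `s = φ t` Lipschitz in `t`.
  have hs : ∀ t ∈ Icc 0 T, ∀ s ∈ Icc (-S) S, ∀ s' ∈ Icc (-S) S,
      |f (g t * e s) - f (g t * e s')| ≤ Q * ‖X‖ * |s - s'| := by
    intro t ht s hs s' hs'
    refine Convex.norm_image_sub_le_of_norm_hasDerivWithin_le
      (f := fun s => f (g t * e s)) (f' := fun s => leftDiff E f (g t * e s) X) (fun r hr => ?_)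
      (fun r hr => ?_) (convex_Icc (-S) S) hs' hs
    · refine (hasDerivAt_comp_of_hasMFDerivAt (γ := fun r => g t * e r) hf1 ?_).hasDerivWithinAt
      refine ((mdifferentiable_mul_left (g t) (e r)).hasMFDerivAt.comp r
        (he.hasMFDerivAt r)).congr_mfderiv ?_
      ext
      show tderiv E E (g t * ·) (e r) ((1 : ℝ) • leftField X (e r)) =
        (1 : ℝ) • leftField X (g t * e r)
      rw [one_smul, one_smul, tderiv_mul_left_leftField]
    · exact (ContinuousLinearMap.le_opNorm _ _).trans
        (mul_le_mul_of_nonneg_right (hQ' t ht r hr) (norm_nonneg _))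
  have ht : ∀ s ∈ Icc (-S) S, ∀ t ∈ Icc 0 T, ∀ t' ∈ Icc 0 T,
      |f (g t * e s) - f (g t' * e s)| ≤ Q * (R * M) * |t - t'| := by
    intro s hs
    -- Absolute continuity of `g` is tested on the right translate `x ↦ f (x * e s)`, which is again
    -- smooth.
    refine abs_sub_le_of_ae_hasDerivAt (f := fun t => f (g t * e s)) hT
      (hg (fun x => f (x * e s)) (hf.comp contMDiff_mul_right)) ?_
    filter_upwards [hder, ae_restrict_mem measurableSet_Icc] with t ht htI
    have h1 := hasMFDerivAt_mul_oneParam he ht (hasDerivAt_const t s)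
    rw [zero_smul, add_zero] at h1
    refine ⟨_, hasDerivAt_comp_of_hasMFDerivAt (γ := fun t => g t * e s) hf1 h1, ?_⟩
    refine (ContinuousLinearMap.le_opNorm _ _).trans
      (mul_le_mul (hQ' t htI s hs) ?_ (norm_nonneg _) hQ0)
    exact (ContinuousLinearMap.le_opNorm _ _).trans
      (mul_le_mul (hR s hs) (hW t htI) (norm_nonneg _) hR0)
  refine LipschitzOnWith.absolutelyContinuousOnInterval
    (K := Real.toNNReal (Q * ‖X‖ * K + Q * (R * M))) ?_
  rw [uIcc_of_le hT]
  refine LipschitzOnWith.of_dist_le_mul fun t htI t' htI' => ?_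
  rw [Real.coe_toNNReal _ (by positivity), Real.dist_eq, Real.dist_eq, add_mul]
  refine (abs_sub_le _ (f (g t * e (φ t'))) _).trans (add_le_add ?_ (ht _ (hφS t' htI') t htI t' htI'))
  refine (hs t htI _ (hφS t htI) _ (hφS t' htI')).trans ?_
  rw [mul_assoc _ (K : ℝ)]
  refine mul_le_mul_of_nonneg_left ?_ (by positivity)
  have := hφ.dist_le_mul t t'
  rwa [Real.dist_eq, Real.dist_eq] at this

end

section

variable {E : Type*} [NormedAddCommGroup E] [NormedSpace ℝ E]

theorem aestronglyMeasurable_bilin [FiniteDimensional ℝ E] (B : E →ₗ[ℝ] E →ₗ[ℝ] ℝ) {μ : Measure ℝ}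
    {f g : ℝ → E} (hf : AEStronglyMeasurable f μ) (hg : AEStronglyMeasurable g μ) :
    AEStronglyMeasurable (fun t => B (f t) (g t)) μ := by
  have h : Continuous fun p : E × E => B.toContinuousBilinearMap p.1 p.2 := by fun_prop
  exact h.comp_aestronglyMeasurable (hf.prodMk hg)

theorem aestronglyMeasurable_clm_add_smul {Φ : ℝ → E →L[ℝ] E} (hΦ : Continuous Φ) {μ : Measure ℝ}
    {u : ℝ → E} (hu : AEStronglyMeasurable u μ) {v : ℝ → ℝ} (hv : AEStronglyMeasurable v μ)
    (x : E) : AEStronglyMeasurable (fun t => Φ t (u t) + v t • x) μ := by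
  have h3 : AEStronglyMeasurable (fun t => Φ t (u t)) μ :=
    isBoundedBilinearMap_apply.continuous.comp_aestronglyMeasurable
      (hΦ.aestronglyMeasurable.prodMk hu)
  exact h3.add (hv.smul aestronglyMeasurable_const)

end

/-! ### The varied controls and their cost -/

section

variable {E : Type*} [NormedAddCommGroup E] [NormedSpace ℝ E] [FiniteDimensional ℝ E]
  {G : Type*} [TopologicalSpace G] [ChartedSpace E G] [Group G] [LieGroup 𝓘(ℝ, E) ∞ G]
  {σ : G →* G} {c T : ℝ} {A X : LieAlg E G} {U : ℝ → LieAlg E G}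

/-- The control of the trajectory `g(t) e(φ(t))` if `g` has control `U`, where `e` is the
one-parameter subgroup of `X` and `v = φ'`. -/
noncomputable def variedControl (X : LieAlg E G) (e : ℝ → G) (φ v : ℝ → ℝ) (U : ℝ → LieAlg E G)
    (t : ℝ) : LieAlg E G :=
  Ad (e (φ t))⁻¹ (U t) + v t • X

theorem cost_eq (c : ℝ) (hT : 0 ≤ T) (U : ℝ → LieAlg E G) :
    cost c T U = (1 / 2) * ∫ t, form c (U t) (U t) ∂volume.restrict (Icc 0 T) := by
  rw [cost, intervalIntegral.integral_of_le hT, integral_Icc_eq_integral_Ioc]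

theorem IsControl.aestronglyMeasurable_form (hU : IsControl σ c T U) :
    AEStronglyMeasurable (fun t => form c (U t) (U t)) (volume.restrict (Icc 0 T)) := by
  let B : E →ₗ[ℝ] E →ₗ[ℝ] ℝ := c • killingForm ℝ (LieAlg E G)
  exact aestronglyMeasurable_bilin B hU.measurable hU.measurable

theorem IsControl.aestronglyMeasurable_form_left (hU : IsControl σ c T U) (X : LieAlg E G) :
    AEStronglyMeasurable (fun t => form c (U t) X) (volume.restrict (Icc 0 T)) := by
  let B : E →ₗ[ℝ] E →ₗ[ℝ] ℝ := c • killingForm ℝ (LieAlg E G)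
  exact aestronglyMeasurable_bilin (E := E) B hU.measurable
    (aestronglyMeasurable_const (b := (X : E)))

theorem IsCompactPair.form_self_nonneg (h : IsCompactPair E σ c) {X : LieAlg E G}
    (hX : X ∈ kSpace σ) : 0 ≤ form c X X := by
  rcases eq_or_ne X 0 with rfl | hne
  · rw [form_zero_left]
  · exact (h.pos X hX hne).le

theorem IsCompactPair.two_mul_form_le (h : IsCompactPair E σ c) {X Y : LieAlg E G}
    (hX : X ∈ kSpace σ) (hY : Y ∈ kSpace σ) : 2 * form c X Y ≤ form c X X + form c Y Y := by
  have h1 := h.form_self_nonneg ((kSpace σ).sub_mem hX hY)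
  rw [form_sub_left, form_sub_right, form_sub_right, form_comm c Y X] at h1
  linarith

/-- `Ad (e s)` is an isometry fixing `X`, so only `v`, not `φ`, enters the change of the cost
density. -/
theorem form_variedControl {e : ℝ → G} (hX : ∀ s, Ad (e s) X = X) (φ v : ℝ → ℝ) (t : ℝ) :
    form c (variedControl X e φ v U t) (variedControl X e φ v U t) =
      form c (U t) (U t) + 2 * v t * form c (U t) X + v t ^ 2 * form c X X := by
  have h1 : form c (Ad (e (φ t))⁻¹ (U t)) X = form c (U t) X := by
    have h2 : Ad (e (φ t))⁻¹ X = X := by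
      conv_lhs => rw [← hX (φ t)]
      exact AdL_inv_AdL (E := E) (e (φ t)) X
    conv_lhs => rw [← h2, form_Ad]
  rw [variedControl, form_add_left, form_add_right, form_add_right, form_Ad, form_smul_left,
    form_smul_left, form_smul_right, form_smul_right, form_comm c X, h1]
  ring

theorem IsControl.variedControl (h : IsCompactPair E σ c) (hU : IsControl σ c T U)
    (hXk : X ∈ kSpace σ) {e : ℝ → G} (hec : Continuous e) (heσ : ∀ s, σ (e s) = e s)
    (hX : ∀ s, Ad (e s) X = X) {φ v : ℝ → ℝ} (hφ : Continuous φ)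
    (hv : AEStronglyMeasurable v (volume.restrict (Icc 0 T))) {V : ℝ} (hV : ∀ t, |v t| ≤ V) :
    IsControl σ c T (variedControl X e φ v U) where
  mem t ht := by
    refine (kSpace σ).add_mem ?_ ((kSpace σ).smul_mem _ hXk)
    have h1 := tderiv_AdL (E := E) σ (h.smooth.mdifferentiable (by simp)) (e (φ t))⁻¹ (U t)
    rw [map_inv, heσ] at h1
    exact h1.trans (congrArg _ (hU.mem t ht))
  measurable := by
    have hgrp : IsTopologicalGroup G := topologicalGroup_of_lieGroup 𝓘(ℝ, E) ∞
    have h2 : Continuous fun t => AdL E (e (φ t))⁻¹ :=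
      contMDiff_AdL.continuous.comp (hec.comp hφ).inv
    exact aestronglyMeasurable_clm_add_smul (E := E) h2 hU.measurable hv X
  bounded := by
    obtain ⟨C, hC⟩ := hU.bounded
    -- From `‖a + b‖² ≤ 2 ‖a‖² + 2 ‖b‖²` in the form on `𝔨`.
    refine ⟨2 * C + 2 * (V ^ 2 * form c X X), fun t ht => ?_⟩
    rw [form_variedControl hX]
    have h1 := h.two_mul_form_le (hU.mem t ht) ((kSpace σ).smul_mem (v t) hXk)
    rw [form_smul_left, form_smul_right, form_smul_right] at h1
    have h2 : v t ^ 2 * form c X X ≤ V ^ 2 * form c X X := by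
      refine mul_le_mul_of_nonneg_right ?_ (h.form_self_nonneg hXk)
      rw [← sq_abs]
      exact pow_le_pow_left₀ (abs_nonneg _) (hV t) 2
    nlinarith [hC t ht]

/-- The subgroup fixes `A`, so right translation leaves the drift `A` in place and changes only the
control. -/
theorem IsSolution.mul_oneParam (h : IsCompactPair E σ c) (hT : 0 ≤ T) (hU : IsControl σ c T U)
    {g : ℝ → G} (hg : IsSolution T A g U) {e : ℝ → G} (he : IsOneParam (E := E) X e)
    (hA : ∀ s, Ad (e s) A = A) {φ v : ℝ → ℝ} {K : NNReal} (hφ : LipschitzWith K φ)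
    (hv : ∀ᵐ t, HasDerivAt φ (v t) t) :
    IsSolution T A (fun t => g t * e (φ t)) (AffineKilling.variedControl X e φ v U) where
  continuousOn := by
    have hgrp : IsTopologicalGroup G := topologicalGroup_of_lieGroup 𝓘(ℝ, E) ∞
    exact hg.continuousOn.mul (he.curve.continuous.comp hφ.continuous).continuousOn
  absolutelyContinuous f hf := by
    obtain ⟨M, hM⟩ := hU.exists_norm_le h
    exact absolutelyContinuousOnInterval_mul_oneParam (E := E) (W := fun t => A + U t) (M := @norm E _ A + M)
      hT hg.continuousOn hg.absolutelyContinuous hg.derivative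
      (fun t ht => (norm_add_le (E := E) A (U t)).trans (add_le_add_right (hM t ht) _)) he hφ hf
  derivative := by
    filter_upwards [hg.derivative, ae_restrict_of_ae hv] with t ht hvt
    have h1 := hasMFDerivAt_mul_oneParam (E := E) (Y := A + U t) (X := X) he ht hvt
    have h3 : Ad (e (φ t))⁻¹ A = A := by
      conv_lhs => rw [← hA (φ t)]
      exact AdL_inv_AdL (E := E) (e (φ t)) A
    have h4 : Ad (e (φ t))⁻¹ (A + U t) + v t • X =
        A + AffineKilling.variedControl X e φ v U t := by
      rw [AffineKilling.variedControl, map_add, h3, add_assoc]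
    exact h1.congr_mfderiv (congrArg (fun Z : E => ((1 : ℝ →L[ℝ] ℝ).smulRight
      (leftField Z (g t * e (φ t)) : E) : ℝ →L[ℝ] E)) h4)

end

/-! ### The du Bois-Reymond lemma -/

section

/-- The du Bois-Reymond lemma, for the first variation of a quadratic functional. -/
theorem exists_ae_eq_const_of_variation_nonneg {u : ℝ → ℝ} {T M q : ℝ} (hT : 0 < T)
    (hu : AEStronglyMeasurable u (volume.restrict (Icc 0 T))) (hM : ∀ t ∈ Icc 0 T, |u t| ≤ M)
    (h : ∀ (φ v : ℝ → ℝ) (K : NNReal) (V : ℝ), LipschitzWith K φ → φ 0 = 0 → φ T = 0 →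
      (∀ᵐ t, HasDerivAt φ (v t) t) → AEStronglyMeasurable v (volume.restrict (Icc 0 T)) →
      (∀ t, |v t| ≤ V) → 0 ≤ ∫ t in Icc 0 T, (2 * v t * u t + v t ^ 2 * q)) :
    ∃ m, ∀ᵐ t ∂volume.restrict (Icc 0 T), u t = m := by
  set μ := volume.restrict (Icc 0 T) with hμ
  set m := (∫ t in Icc 0 T, u t) / T with hm
  -- Subtracting the mean makes the primitive of `w` vanish at `T`; the cutoff makes this primitive
  -- Lipschitz on the whole line. Its multiples serve as `φ`.
  set w : ℝ → ℝ := (Icc 0 T).indicator fun t => u t - m with hw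
  have hwI : ∀ t ∈ Icc 0 T, w t = u t - m := fun t ht => indicator_of_mem ht _
  have hM0 : 0 ≤ M := (abs_nonneg _).trans (hM 0 (left_mem_Icc.2 hT.le))
  have hwV : ∀ t, |w t| ≤ M + |m| := by
    intro t
    by_cases ht : t ∈ Icc 0 T
    · rw [hwI t ht]
      exact (abs_sub _ _).trans (add_le_add_left (hM t ht) _)
    · rw [hw, indicator_of_notMem ht, abs_zero]
      positivity
  have hui : Integrable u μ :=
    Integrable.of_bound hu M ((ae_restrict_mem measurableSet_Icc).mono hM)
  have hwi : Integrable w := (integrable_indicator_iff measurableSet_Icc).2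
    (hui.sub (integrable_const m))
  have hwm : AEStronglyMeasurable w μ := hwi.aestronglyMeasurable.restrict
  have hw0 : ∫ t, w t ∂μ = 0 := by
    rw [hμ, setIntegral_congr_fun measurableSet_Icc hwI, integral_sub hui (integrable_const m)]
    have h1 : ∫ _ in Icc 0 T, m = T * m := by simp [hT.le]
    rw [h1, hm, mul_div_cancel₀ _ hT.ne', sub_self]
  have hwui : Integrable (fun t => w t * u t) μ :=
    hui.bdd_mul hwm (ae_of_all _ hwV)
  have hwwi : Integrable (fun t => w t ^ 2) μ := by
    simp_rw [sq]
    exact hwi.restrict.bdd_mul hwm (ae_of_all _ hwV)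
  -- A nonnegative quadratic in `η` without constant term has zero linear coefficient. Thus `∫ w u =
  -- 0`, and `∫ w = 0` then gives `∫ w² = 0`.
  have hvar : ∀ η : ℝ, 0 ≤ (q * ∫ t, w t ^ 2 ∂μ) * (η * η) + (2 * ∫ t, w t * u t ∂μ) * η + 0 := by
    intro η
    have h1 := h (fun t => η * ∫ s in (0 : ℝ)..t, w s) (fun t => η * w t)
      (Real.toNNReal (|η| * (M + |m|))) (|η| * (M + |m|)) ?_ (by simp) ?_ ?_
      (hwm.const_mul η) (fun t => ?_)
    · have h2 : ∀ t, 2 * (η * w t) * u t + (η * w t) ^ 2 * q =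
          (2 * η) * (w t * u t) + (η ^ 2 * q) * w t ^ 2 := fun t => by ring
      simp_rw [h2] at h1
      rw [integral_add (hwui.const_mul _) (hwwi.const_mul _), integral_const_mul,
        integral_const_mul] at h1
      linarith
    · refine LipschitzWith.of_dist_le_mul fun x y => ?_
      rw [Real.coe_toNNReal _ (by positivity), Real.dist_eq, Real.dist_eq, ← mul_sub,
        intervalIntegral.integral_interval_sub_left hwi.intervalIntegrable hwi.intervalIntegrable,
        abs_mul, mul_assoc]
      exact mul_le_mul_of_nonneg_left
        (intervalIntegral.norm_integral_le_of_norm_le_const (f := w) fun t _ => hwV t)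
        (abs_nonneg _)
    · rw [intervalIntegral.integral_of_le hT.le, ← integral_Icc_eq_integral_Ioc]
      exact mul_eq_zero_of_right _ hw0
    · filter_upwards [LocallyIntegrable.ae_hasDerivAt_integral hwi.locallyIntegrable] with t ht
      exact (ht 0).const_mul η
    · rw [abs_mul]
      exact mul_le_mul_of_nonneg_left (hwV t) (abs_nonneg _)
  have hd := discrim_le_zero hvar
  have ha : ∫ t, w t * u t ∂μ = 0 := by
    rw [discrim] at hd
    nlinarith [sq_nonneg (∫ t, w t * u t ∂μ)]
  have hww : ∫ t, w t ^ 2 ∂μ = 0 := by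
    have h1 : ∀ t ∈ Icc 0 T, w t ^ 2 = w t * u t - m * w t := fun t ht => by
      rw [hwI t ht]; ring
    rw [hμ, setIntegral_congr_fun measurableSet_Icc h1,
      integral_sub hwui (hwi.restrict.const_mul m), integral_const_mul]
    rw [ha, hw0]
    ring
  have hz := (integral_eq_zero_iff_of_nonneg (fun t => sq_nonneg (w t)) hwwi).1 hww
  refine ⟨m, ?_⟩
  filter_upwards [hz, ae_restrict_mem measurableSet_Icc] with t ht htI
  have h1 : w t = 0 := pow_eq_zero_iff two_ne_zero |>.1 ht
  rw [hwI t htI] at h1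
  linarith

end

/-! ### Constancy of optimal controls and normal lifts -/

section

variable {E : Type*} [NormedAddCommGroup E] [NormedSpace ℝ E] [FiniteDimensional ℝ E]
  {G : Type*} [TopologicalSpace G] [T2Space G] [ChartedSpace E G] [Group G] [LieGroup 𝓘(ℝ, E) ∞ G]
  {σ : G →* G} {c ε s T : ℝ} {A X : LieAlg E G} {U : ℝ → LieAlg E G}

theorem IsCompactPair.exists_isOneParam (h : IsCompactPair E σ c) (hX : X ∈ kSpace σ)
    (hAX : ⁅A, X⁆ = 0) : ∃ e : ℝ → G, IsOneParam (E := E) X e ∧ (∀ s, σ (e s) = e s) ∧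
      (∀ s, Ad (e s) X = X) ∧ ∀ s, Ad (e s) A = A := by
  obtain ⟨e, he⟩ := AffineKilling.exists_isOneParam (E := E) G X
  refine ⟨e, he, fun s => ?_, he.AdL_self, he.AdL_eq_self ?_⟩
  · have h1 := he.map σ (h.smooth.mdifferentiable (by simp))
    have h2 : tderiv E E σ 1 X = X := hX
    rw [h2] at h1
    exact congrFun (h1.unique he) s
  · have h1 : ⁅X, A⁆ = 0 := by rw [← lie_skew, hAX, neg_zero]
    exact (adD_eq_lie X A).trans h1

omit [T2Space G] in
/-- The control of a trajectory, which is a minimum for the variations by a one-parameter group of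
symmetries, has a constant component in the direction of that group. -/
theorem IsControl.exists_ae_form_eq_const (h : IsCompactPair E σ c) (hT : 0 < T)
    (hU : IsControl σ c T U) (hX : X ∈ kSpace σ) {e : ℝ → G} (he : IsOneParam (E := E) X e)
    (heσ : ∀ s, σ (e s) = e s) (heX : ∀ s, Ad (e s) X = X)
    (hmin : ∀ (φ v : ℝ → ℝ) (K : NNReal), LipschitzWith K φ → φ 0 = 0 → φ T = 0 →
      (∀ᵐ t, HasDerivAt φ (v t) t) → IsControl σ c T (AffineKilling.variedControl X e φ v U) →
      cost c T U ≤ cost c T (AffineKilling.variedControl X e φ v U)) :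
    ∃ m, ∀ᵐ t ∂volume.restrict (Icc 0 T), form c (U t) X = m := by
  obtain ⟨C, hC⟩ := hU.bounded
  have hUX : ∀ t ∈ Icc 0 T, |form c (U t) X| ≤ C + form c X X := fun t ht => by
    have h1 := h.two_mul_form_le (hU.mem t ht) hX
    have h2 := h.two_mul_form_le (hU.mem t ht) ((kSpace σ).neg_mem hX)
    rw [form_neg_left, form_neg_right, form_neg_right] at h2
    have h3 := hC t ht
    have h4 := h.form_self_nonneg (hU.mem t ht)
    have h5 := h.form_self_nonneg hX
    exact abs_le.2 ⟨by linarith, by linarith⟩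
  refine exists_ae_eq_const_of_variation_nonneg (M := C + form c X X) (q := form c X X) hT
    (hU.aestronglyMeasurable_form_left X) hUX fun φ v K V hφ h0 hT0 hd hv hV => ?_
  have h1 := hmin φ v K hφ h0 hT0 hd
    (hU.variedControl h hX he.curve.continuous heσ heX hφ.continuous hv hV)
  have hUi : Integrable (fun t => form c (U t) (U t)) (volume.restrict (Icc 0 T)) := by
    refine Integrable.of_bound hU.aestronglyMeasurable_form C ?_
    filter_upwards [ae_restrict_mem measurableSet_Icc] with t ht
    rw [Real.norm_eq_abs, abs_of_nonneg (h.form_self_nonneg (hU.mem t ht))]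
    exact hC t ht
  have hUXi : Integrable (fun t => form c (U t) X) (volume.restrict (Icc 0 T)) :=
    Integrable.of_bound (hU.aestronglyMeasurable_form_left X) (C + form c X X)
      ((ae_restrict_mem measurableSet_Icc).mono hUX)
  have hi1 : Integrable (fun t => 2 * v t * form c (U t) X) (volume.restrict (Icc 0 T)) :=
    hUXi.bdd_mul (hv.const_mul 2) (c := 2 * V) (ae_of_all _ fun t => by
      rw [norm_mul, Real.norm_eq_abs, Real.norm_eq_abs, abs_two]
      exact mul_le_mul_of_nonneg_left (hV t) zero_le_two)
  have hi2 : Integrable (fun t => v t ^ 2 * form c X X) (volume.restrict (Icc 0 T)) := by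
    have hv1 : Integrable v (volume.restrict (Icc 0 T)) := Integrable.of_bound hv V (ae_of_all _ hV)
    simp_rw [sq]
    exact (hv1.bdd_mul hv (ae_of_all _ hV)).mul_const _
  have hi : Integrable (fun t => 2 * v t * form c (U t) X + v t ^ 2 * form c X X)
      (volume.restrict (Icc 0 T)) := hi1.add hi2
  rw [cost_eq c hT.le, cost_eq c hT.le] at h1
  simp_rw [form_variedControl heX, add_assoc] at h1
  rw [integral_add hUi hi] at h1
  linarith

variable [LieAlgebra.IsSemisimple ℝ (LieAlg E G)]

/-- By Jacobi `[V, A] ∈ 𝔭` commutes with `L`. For `Y ∈ 𝔭` commuting with `L`, `⟨[V, A], Y⟩ = ⟨V, [A,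
Y]⟩ = 0` by regularity of `L`, so nondegeneracy on the centralizer of `L` applies. -/
theorem IsCompactPair.lie_eq_zero_of_isRegular (h : IsCompactPair E σ c) {L V : LieAlg E G}
    (hL : IsRegular σ L) (hA : A ∈ pSpace σ) (hAL : ⁅A, L⁆ = 0) (hV : V ∈ kSpace σ)
    (hLV : ⁅L, V⁆ = 0) : ⁅A, V⁆ = 0 := by
  have hLA : ⁅L, A⁆ = 0 := by rw [← lie_skew, hAL, neg_zero]
  have h1 : ⁅V, A⁆ = 0 := by
    refine h.eq_zero_of_centralizer hL.1 (h.lie_kp hV hA) ?_ fun Y hY hLY => ?_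
    · rw [leibniz_lie, hLV, hLA, zero_lie, lie_zero, add_zero]
    · rw [form_lie, hL.2 A hA Y hY hLA hLY, form_zero_right]
  rw [← lie_skew, h1, neg_zero]

omit [T2Space G] [LieAlgebra.IsSemisimple ℝ (LieAlg E G)] in
theorem IsControl.isConstantCommuting (h : IsCompactPair E σ c) (hT : 0 < T)
    (hU : IsControl σ c T U) (hAU : ∀ᵐ t ∂volume.restrict (Icc 0 T), ⁅A, U t⁆ = 0)
    (hconst : ∀ X ∈ kSpace (E := E) σ, ⁅A, X⁆ = 0 →
      ∃ m, ∀ᵐ t ∂volume.restrict (Icc 0 T), form c (U t) X = m) :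
    IsConstantCommuting σ T A U := by
  have hfin : FiniteDimensional ℝ (LieAlg E G) := inferInstanceAs (FiniteDimensional ℝ E)
  -- On the centralizer of `A` in `𝔨` the form is definite, and the pairings of `U` with a finite
  -- basis are constant off one null set. Hence `U t - U t₀`, an element of `S`, is orthogonal to
  -- `S` and zero.
  let S : Submodule ℝ (LieAlg E G) :=
    kSpace σ ⊓ LinearMap.ker (LieAlgebra.ad ℝ (LieAlg E G) A : LieAlg E G →ₗ[ℝ] LieAlg E G)
  let b := Module.finBasis ℝ S
  choose m hm using fun i => hconst (b i) (b i).2.1 (LinearMap.mem_ker.1 (b i).2.2)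
  have hall := (ae_all_iff.2 hm).and (hAU.and (ae_restrict_mem measurableSet_Icc))
  have hne : (ae (volume.restrict (Icc 0 T))).NeBot := by
    rw [ae_restrict_neBot, Real.volume_Icc, sub_zero]
    exact (ENNReal.ofReal_pos.2 hT).ne'
  obtain ⟨t₀, ht₀, hA₀, hI₀⟩ := hall.exists
  refine ⟨U t₀, hU.mem t₀ hI₀, hA₀, ?_⟩
  filter_upwards [hall] with t ⟨ht, hAt, hIt⟩
  have hk : U t - U t₀ ∈ kSpace σ := (kSpace σ).sub_mem (hU.mem t hIt) (hU.mem t₀ hI₀)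
  have hS : U t - U t₀ ∈ S := ⟨hk, LinearMap.mem_ker.2
    ((lie_sub A (U t) (U t₀)).trans (by rw [hAt, hA₀, sub_zero]))⟩
  let f : S →ₗ[ℝ] ℝ := (covector c (U t - U t₀)).comp S.subtype
  have hf : f = 0 := b.ext fun i => by
    show form c (U t - U t₀) (b i) = 0
    rw [form_sub_left, ht i, ht₀ i, sub_self]
  exact sub_eq_zero.1 (h.eq_zero_of_form_self hk (LinearMap.congr_fun hf ⟨_, hS⟩))

-- The constant lift is `⟨U₀, ·⟩`. It is stationary for every `s` because `U₀` commutes with `A` and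
-- the term with `s` involves `⟨U₀, [A, ·]⟩`; maximality is completion of the square.
omit [T2Space G] [LieAlgebra.IsSemisimple ℝ (LieAlg E G)] in
theorem IsConstantCommuting.exists_normal_lift (h : IsCompactPair E σ c) (hA : A ∈ pSpace σ)
    (hT : 0 < T) (hU : IsConstantCommuting σ T A U) (ε s : ℝ) :
    ∃ l, IsExtremalLift σ c ε s T A (-1) l U := by
  obtain ⟨U₀, hk, hAU, hU⟩ := hU
  have hlie : ∀ X, form c U₀ (deformedBracket σ s (A + U₀) X) = 0 := by
    intro X
    have h1 : form c U₀ ⁅U₀, kPart σ X⁆ = 0 := by rw [← form_lie, lie_self, form_zero_left]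
    have h2 : form c U₀ ⁅A, pPart σ X⁆ = 0 := by
      rw [← form_lie, ← lie_skew, hAU, neg_zero, form_zero_left]
    rw [deformedBracket, kPart_add, pPart_add, kPart_of_mem_pSpace hA, kPart_of_mem_kSpace hk,
      pPart_of_mem_pSpace hA, pPart_of_mem_kSpace hk, zero_add, add_zero, form_add_right,
      form_add_right, form_sub_right, form_smul_right, h1, h2,
      h.form_kp hk (h.lie_kp hk (h.pPart_mem X)), h.form_kp hk (h.lie_kp (h.kPart_mem X) hA)]
    ring
  refine ⟨fun _ => covector c U₀, ⟨fun X => ?_, fun X => ?_, by norm_num, by norm_num, ?_⟩⟩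
  · exact absolutelyContinuousOnInterval_of_eqOn hT.le (a := covector c U₀ X) fun t _ => rfl
  · filter_upwards [hU] with t ht
    have h1 : covector c U₀ (deformedBracket σ s (A + U t) X) = 0 := ht ▸ hlie X
    rw [h1, mul_zero]
    exact hasDerivAt_const t _
  · filter_upwards [hU] with t ht V hV
    have h1 := h.two_mul_form_le hk hV
    rw [hamiltonian, hamiltonian, ht, map_add, map_add, covector_apply, covector_apply,
      covector_apply, h.form_kp hk hA]
    linarith

end

/-! ### Optimality implies minimality for the variations -/

section

variable {E : Type*} [NormedAddCommGroup E] [NormedSpace ℝ E] [FiniteDimensional ℝ E]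
  {G : Type*} [TopologicalSpace G] [T2Space G] [ChartedSpace E G] [Group G] [LieGroup 𝓘(ℝ, E) ∞ G]
  {σ : G →* G} {c T : ℝ} {A X : LieAlg E G} {U : ℝ → LieAlg E G}

/-- The control has minimal cost among the variations by one-parameter subgroups of `K` which fix
`A`. -/
def IsMinimalForVariations (σ : G →* G) (c T : ℝ) (A : LieAlg E G) (U : ℝ → LieAlg E G) : Prop :=
  ∀ (X : LieAlg E G) (e : ℝ → G) (φ v : ℝ → ℝ) (K : NNReal), IsOneParam (E := E) X e →
    (∀ s, σ (e s) = e s) → (∀ s, Ad (e s) A = A) → LipschitzWith K φ → φ 0 = 0 → φ T = 0 →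
    (∀ᵐ t, HasDerivAt φ (v t) t) → IsControl σ c T (variedControl X e φ v U) →
    cost c T U ≤ cost c T (variedControl X e φ v U)

omit [T2Space G] in
theorem IsOptimal.isMinimalForVariations (h : IsCompactPair E σ c) (hT : 0 ≤ T) {g : ℝ → G}
    (hg : IsOptimal σ c T A g U) : IsMinimalForVariations σ c T A U := by
  intro X e φ v K he _ heA hφ h0 hT0 hv hU'
  refine hg.2 (fun t => g t * e (φ t)) _
    ⟨hU', hg.1.solution.mul_oneParam h hT hg.1.control he heA hφ hv⟩ ?_ ?_
  · rw [h0, he.zero, mul_one]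
  · rw [hT0, he.zero, mul_one]

-- Since `Ad (e s) A = A`, the variation of `h` does not change `Ad_h A`, so the same curve `x`
-- completes the competitor. The second component is a trajectory with drift `0`.
omit [T2Space G] in
theorem IsShadowOptimal.isMinimalForVariations (h : IsCompactPair E σ c) (hT : 0 ≤ T)
    {x : ℝ → LieAlg E G} {g : ℝ → G} (hg : IsShadowOptimal σ c T A x g U) :
    IsMinimalForVariations σ c T A U := by
  intro X e φ v K he heσ heA hφ h0 hT0 hv hU'
  have hA : ∀ t, Ad (g t * e (φ t)) A = Ad (g t) A := fun t => by
    have h1 : Ad (g t * e (φ t)) A = Ad (g t) (Ad (e (φ t)) A) :=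
      AdL_mul (E := E) (g t) (e (φ t)) A
    rw [h1, heA]
  refine hg.2 x (fun t => g t * e (φ t)) _
    ⟨hU', hg.1.mem_p, fun t ht => ?_, hg.1.solution_h.mul_oneParam h hT hg.1.control he ?_ hφ hv,
      hg.1.absolutelyContinuous_x, fun ψ => ?_⟩ rfl ?_ rfl ?_
  · rw [map_mul, heσ, hg.1.mem_K t ht]
  · exact fun s => map_zero _
  · simp_rw [hA]
    exact hg.1.derivative_x ψ
  · rw [h0, he.zero, mul_one]
  · rw [hT0, he.zero, mul_one]

theorem IsMinimalForVariations.isConstantCommuting [LieAlgebra.IsSemisimple ℝ (LieAlg E G)]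
    (h : IsCompactPair E σ c) (hA : A ∈ pSpace σ) (hT : 0 < T) (hU : IsControl σ c T U)
    {L : LieAlg E G} {l : ℝ → Module.Dual ℝ (LieAlg E G)}
    (hl : AbnormalConstraints σ c T A L l U) (hL : IsRegular σ L)
    (hmin : IsMinimalForVariations σ c T A U) : IsConstantCommuting σ T A U := by
  refine hU.isConstantCommuting h hT ?_ fun X hX hAX => ?_
  · filter_upwards [hl.lie_U, ae_restrict_mem measurableSet_Icc] with t ht htI
    exact h.lie_eq_zero_of_isRegular hL hA hl.lie_A (hU.mem t htI) ht
  · obtain ⟨e, he, heσ, heX, heA⟩ := h.exists_isOneParam hX hAX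
    exact hU.exists_ae_form_eq_const h hT hX he heσ heX fun φ v K hφ h0 hT0 hv hU' =>
      hmin X e φ v K he heσ heA hφ h0 hT0 hv hU'

end

end AffineKilling

theorem mainTheorem3
    {E : Type*} [NormedAddCommGroup E] [NormedSpace ℝ E] [FiniteDimensional ℝ E]
    {G : Type*} [TopologicalSpace G] [T2Space G] [SecondCountableTopology G] [ConnectedSpace G]
    [ChartedSpace E G] [Group G] [LieGroup 𝓘(ℝ, E) ∞ G]
    [LieAlgebra.IsSemisimple ℝ (AffineKilling.LieAlg E G)]
    (σ : G →* G) (hσ_smooth : ContMDiff 𝓘(ℝ, E) 𝓘(ℝ, E) ∞ σ)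
    (hσ_invol : ∀ g : G, σ (σ g) = g) (hσ_ne : ∃ g : G, σ g ≠ g)
    (hK : IsCompact {g : G | σ g = g})
    (c : ℝ)
    (hc : ∀ X ∈ AffineKilling.kSpace (E := E) σ, X ≠ 0 → 0 < AffineKilling.form c X X)
    (A : AffineKilling.LieAlg E G) (hA : AffineKilling.IsRegular σ A)
    (T : ℝ) (hT : 0 < T)
    (ε : ℝ) (hε : ε = 1 ∨ ε = -1) :
    (∀ (g : ℝ → G) (l : ℝ → Module.Dual ℝ (AffineKilling.LieAlg E G))
        (U : ℝ → AffineKilling.LieAlg E G),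
      AffineKilling.IsAbnormalExtremal σ c ε T A g l U ↔
        AffineKilling.IsTrajectory σ c T A g U ∧
          ∃ L : AffineKilling.LieAlg E G, L ≠ 0 ∧
            AffineKilling.AbnormalConstraints σ c T A L l U) ∧
    (∀ (g : ℝ → G) (l : ℝ → Module.Dual ℝ (AffineKilling.LieAlg E G))
        (U : ℝ → AffineKilling.LieAlg E G) (L : AffineKilling.LieAlg E G),
      AffineKilling.IsAbnormalExtremal σ c ε T A g l U →
      AffineKilling.AbnormalConstraints σ c T A L l U →
      AffineKilling.IsRegular σ L →
      AffineKilling.IsOptimal σ c T A g U →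
        (∃ l' : ℝ → Module.Dual ℝ (AffineKilling.LieAlg E G),
          AffineKilling.IsNormalExtremal σ c ε T A g l' U) ∧
        AffineKilling.IsConstantCommuting σ T A U) ∧
    (∀ (x : ℝ → AffineKilling.LieAlg E G) (h : ℝ → G)
        (l : ℝ → Module.Dual ℝ (AffineKilling.LieAlg E G))
        (U : ℝ → AffineKilling.LieAlg E G),
      AffineKilling.IsShadowAbnormalExtremal σ c ε T A x h l U ↔
        AffineKilling.IsShadowTrajectory σ c T A x h U ∧
          ∃ L : AffineKilling.LieAlg E G, L ≠ 0 ∧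
            AffineKilling.AbnormalConstraints σ c T A L l U) ∧
    (∀ (x : ℝ → AffineKilling.LieAlg E G) (h : ℝ → G)
        (l : ℝ → Module.Dual ℝ (AffineKilling.LieAlg E G))
        (U : ℝ → AffineKilling.LieAlg E G) (L : AffineKilling.LieAlg E G),
      AffineKilling.IsShadowAbnormalExtremal σ c ε T A x h l U →
      AffineKilling.AbnormalConstraints σ c T A L l U →
      AffineKilling.IsRegular σ L →
      AffineKilling.IsShadowOptimal σ c T A x h U →
        (∃ l' : ℝ → Module.Dual ℝ (AffineKilling.LieAlg E G),
          AffineKilling.IsShadowNormalExtremal σ c ε T A x h l' U) ∧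
        AffineKilling.IsConstantCommuting σ T A U) := by
  have h := AffineKilling.isCompactPair_of_ne σ hσ_smooth hσ_invol hσ_ne hK c hc
  have hε0 : ε ≠ 0 := by rcases hε with rfl | rfl <;> norm_num
  refine ⟨fun g l U => ⟨fun hgl => ⟨hgl.1, ?_⟩, fun ⟨hg, L, hL0, hL⟩ => ⟨hg, ?_⟩⟩,
    fun g l U L hgl hl hL hopt => ?_, fun x g l U => ⟨fun hgl => ⟨hgl.1, ?_⟩,
    fun ⟨hg, L, hL0, hL⟩ => ⟨hg, ?_⟩⟩, fun x g l U L hgl hl hL hopt => ?_⟩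
  · exact hgl.2.exists_abnormalConstraints h hA hT hε0 hgl.1.control
  · exact hL.isExtremalLift h hA.1 hT hg.control hL0
  · have hU := (hopt.isMinimalForVariations h hT.le).isConstantCommuting h hA.1 hT
      hgl.1.control hl hL
    obtain ⟨l', hl'⟩ := hU.exists_normal_lift h hA.1 hT ε 1
    exact ⟨⟨l', hgl.1, hl'⟩, hU⟩
  · exact hgl.2.exists_abnormalConstraints h hA hT hε0 hgl.1.control
  · exact hL.isExtremalLift h hA.1 hT hg.control hL0
  · have hU := (hopt.isMinimalForVariations h hT.le).isConstantCommuting h hA.1 hT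
      hgl.1.control hl hL
    obtain ⟨l', hl'⟩ := hU.exists_normal_lift h hA.1 hT ε 0
    exact ⟨⟨l', hgl.1, hl'⟩, hU⟩
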